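/- Let $H$ be a real Hilbert space and $\mathsf A:H\to 2^H$ a maximal monotone operator, $S:=\mathsf A^{-1}(0)$ its set of zeros, and $J_\sigma:=(I+\sigma\mathsf A)^{-1}$ ($\sigma>0$) its resolvent functions. Let $u\in H$, $(e_n)\subset H$, $(c_n)\subset(0,\infty)$, $(\lambda_n),(\delta_n)\subset(0,1)$, $(\gamma_n)\subset[0,1)$ with $\lambda_n+\gamma_n+\delta_n=1$ for all $n\in\mathbb N=\{0,1,2,\dots\}$. Let $(z_n)$ and $(y_n)$ satisfy, with $y_0=z_0$, $$z_{n+1}=\lambda_nu+\gamma_nz_n+\delta_nJ_{c_n}(z_n)+e_n,\qquad y_{n+1}=\lambda_nu+\gamma_ny_n+\delta_nJ_{c_n}(y_n).$$ A function $g:\mathbb N\to\mathbb N$ is called monotone if $g(n)\le g(n+1)$ for all $n$. Let $c\in\mathbb N\setminus\{0\}$ and let $h:\mathbb N\to\mathbb N\setminus\{0\}$ and $\ell,L,E:\mathbb N\to\mathbb N$ be monotone functions such that - $(Q_1)$ $\lambda_n\ge \frac1{h(n)}$ for all $n$; - $(Q_2)$ $\lambda_n\le\frac1{k+1}$ for all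 $k$ and all $n\ge\ell(k)$; - $(Q_3)$ $\sum_{i=1}^{L(k)}\lambda_i\ge k$ for all $k$; - $(Q_4)$ $\min\{c_n,\delta_n^2\}\ge\frac1c$ for all $n$; - and either $(Q_{5a})$ $\sum_{i=E(k)+1}^{E(k)+n}\|e_i\|\le\frac1{k+1}$ for all $k,n$, or $(Q_{5b})$ $\frac{\|e_n\|}{\lambda_n}\le\frac1{k+1}$ for all $k$ and all $n\ge E(k)$. Let $D\in\mathbb N\setminus\{0\}$ and $p\in S$ be such that $D\ge\max\{2\|u-p\|,\|z_0-p\|\}$, and put $B_D:=\{x\in H:\|x-p\|\le D\}$. Let $\mathsf C:\mathbb N\to\mathbb N$ be monotone with $c_n\le\mathsf C(n)$ for all $n$. Then for every $k\in\mathbb N$ and every monotone $f:\mathbb N\to\mathbb N$ there are $n\le\mu(k,f)$ and $z\in B_D$ such that $$\|y_i-z\|^2\le\frac1{k+1}\qquad\text{for all } i\in\mathbb N\text{ with } n\le i\le f(n).$$ Here $\mu(k,f)$ is defined as follows, where $g^{(j)}$ denotes the $j$-th iterate of $g:\mathbb N\to\mathbb N$. For $k,m,n\in\mathbb N$ and $g:\mathbb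 N\to\mathbb N$ put $$\zeta(m,n):=c(m+1)\mathsf C(n)-1,\qquad \overline\sigma(k,n):=L\big(n+\lceil\ln(12D^2(k+1))\rceil\big)+1,$$ $$\phi_2(m,n,g):=\max\{n,\,g^{(4D^2(m+1))}(n)\},\qquad \phi_1(m,n,g):=g(\phi_2(m,n,g)).$$ For the given $k$ and $f$ put $\widetilde f(n):=f(\overline\sigma(k,n))$ and let $\widetilde f+2$ be the function $n\mapsto\widetilde f(n)+2$. Further $$r_1(n):=12c(n+1)^2-1,\qquad r_2(n):=\max\{2(n+1),\,128D(k+1)^2\},$$ $$r_3(n):=\ell\big(\max\{96cD^2(n+1)^2-1,\;256D^2(k+1)^2-1,\;16c\,r_2(n)^2D^2\}\big),$$ $$r_4(n):=3(k+1)\big(\widetilde f(\phi_2(r_1(n),r_3(n),\widetilde f+2))+1\big),\qquad \Phi(n):=\phi_1(r_1(n),r_3(n),\widetilde f+2),$$ $$\Xi_1(n):=\zeta\big(2(6D+1)\max\{r_1(n),r_4(n)\}-1,\;\Phi(n)\big),$$ $$\xi(n):=\zeta\big(\max\{16h(f(n))(k+1)^2(6D+1),\;4c\,r_2(n)^2(6D+1)\},\;f(n)\big),$$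 $$\Xi_2(n):=\xi(\Phi(n)),\qquad \Xi(n):=\max\{\Xi_1(n),\Xi_2(n)\}.$$ For $m\in\mathbb N$ and $g:\mathbb N\to\mathbb N$ put $$w_g(n):=\max\{g(24D(n+1)^2),\,24D(n+1)^2\},\qquad \beta(m,g):=24D\big(w_g^{(R)}(0)+1\big)^2\ \text{ with } R:=4D^4(m+1)^2 .$$ Finally, with $\overline k:=32(k+1)^2-1$ and $b:=\beta(\overline k,\Xi)$, $$\mu(k,f):=\max\big\{\overline\sigma\big(k,\phi_2(r_1(b),r_3(b),\widetilde f+2)\big),\;\Phi(b)\big\}.$$ -/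

import Mathlib

namespace MPPA

section Operators

variable {H : Type*} [NormedAddCommGroup H] [InnerProductSpace ℝ H]

/-- A set-valued operator `A : H → 2^H` is monotone if `⟨x - x', v - v'⟩ ≥ 0` for all points
`(x, v)`, `(x', v')` of its graph. -/
def IsMonotoneOp (A : H → Set H) : Prop :=
  ∀ x x' v v' : H, v ∈ A x → v' ∈ A x' → 0 ≤ inner ℝ (x - x') (v - v')

/-- A monotone operator is maximal monotone if its graph is not properly contained in the graph
of another monotone operator. -/
def IsMaximalMonotoneOp (A : H → Set H) : Prop :=
  IsMonotoneOp A ∧ ∀ B : H → Set H, IsMonotoneOp B → (∀ x, A x ⊆ B x) → B = A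

/-- The set `S = A⁻¹(0)` of zeros of `A`. -/
def zeros (A : H → Set H) : Set H := {x | (0 : H) ∈ A x}

/-- The resolvent function `J_σ = (I + σ A)⁻¹`: `J_σ x` is the point `y` with `x ∈ y + σ A y`.
For `A` maximal monotone and `σ > 0` such a point exists and is unique, for every `x`. -/
noncomputable def resolvent (A : H → Set H) (σ : ℝ) (x : H) : H :=
  Classical.epsilon fun y : H => ∃ v ∈ A y, y + σ • v = x

end Operators

/-! The functions from which the bound is built. In the theorem `c`, `D` and all the values of
`C` are positive, so that no subtraction of `1` below truncates. -/

/-- `ζ[c, C](k, n) = c (k + 1) C(n) - 1`. -/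
def zeta (c : ℕ) (C : ℕ → ℕ) (k n : ℕ) : ℕ := c * (k + 1) * C n - 1

/-- `σ̄[L, D](k, n) = L(n + ⌈ln(12 D² (k + 1))⌉) + 1`. -/
noncomputable def sigmaBar (L : ℕ → ℕ) (D : ℕ) (k n : ℕ) : ℕ :=
  L (n + ⌈Real.log (12 * (D : ℝ) ^ 2 * ((k : ℝ) + 1))⌉₊) + 1

/-- `φ₂[D](k, n, f) = max {n, f^(4 D² (k + 1)) (n)}`, with an iterate of `f`. -/
def phi2 (D : ℕ) (k n : ℕ) (f : ℕ → ℕ) : ℕ := max n (f^[4 * D ^ 2 * (k + 1)] n)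

/-- `φ₁[D](k, n, f) = f(φ₂[D](k, n, f))`. -/
def phi1 (D : ℕ) (k n : ℕ) (f : ℕ → ℕ) : ℕ := f (phi2 D k n f)

/-- `f̃[k, f, L, D](n) = f(σ̄(k, n))`. -/
noncomputable def fTilde (k : ℕ) (f L : ℕ → ℕ) (D : ℕ) (n : ℕ) : ℕ := f (sigmaBar L D k n)

/-- The function `f̃ + 2`. -/
noncomputable def fTilde2 (k : ℕ) (f L : ℕ → ℕ) (D : ℕ) (n : ℕ) : ℕ := fTilde k f L D n + 2

/-- `r₁[c](n) = 12 c (n + 1)² - 1`. -/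
def r1 (c n : ℕ) : ℕ := 12 * c * (n + 1) ^ 2 - 1

/-- `r₂[k, D](n) = max {2 (n + 1), 128 D (k + 1)²}`. -/
def r2 (k D n : ℕ) : ℕ := max (2 * (n + 1)) (128 * D * (k + 1) ^ 2)

/-- `r₃[k, c, ℓ, D](n) =
ℓ(max {96 c D² (n + 1)² - 1, 256 D² (k + 1)² - 1, 16 c r₂(n)² D²})`. -/
def r3 (k c : ℕ) (l : ℕ → ℕ) (D n : ℕ) : ℕ :=
  l (max (max (96 * c * D ^ 2 * (n + 1) ^ 2 - 1) (256 * D ^ 2 * (k + 1) ^ 2 - 1))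
    (16 * c * (r2 k D n) ^ 2 * D ^ 2))

/-- `r₄[k, c, f, ℓ, D, L](n) = 3 (k + 1) (f̃(φ₂(r₁(n), r₃(n), f̃ + 2)) + 1)`. -/
noncomputable def r4 (k c : ℕ) (f l : ℕ → ℕ) (D : ℕ) (L : ℕ → ℕ) (n : ℕ) : ℕ :=
  3 * (k + 1) *
    (fTilde k f L D (phi2 D (r1 c n) (r3 k c l D n) (fTilde2 k f L D)) + 1)

/-- `Φ[k, c, f, ℓ, L, D](n) = φ₁(r₁(n), r₃(n), f̃ + 2)`. -/
noncomputable def Phi (k c : ℕ) (f l L : ℕ → ℕ) (D : ℕ) (n : ℕ) : ℕ :=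
  phi1 D (r1 c n) (r3 k c l D n) (fTilde2 k f L D)

/-- `Ξ₁(n) = ζ(2 (6 D + 1) max {r₁(n), r₄(n)} - 1, φ₁(r₁(n), r₃(n), f̃ + 2))`. -/
noncomputable def Xi1 (k : ℕ) (f : ℕ → ℕ) (c : ℕ) (C l L : ℕ → ℕ) (D : ℕ) (n : ℕ) : ℕ :=
  zeta c C (2 * (6 * D + 1) * max (r1 c n) (r4 k c f l D L n) - 1)
    (phi1 D (r1 c n) (r3 k c l D n) (fTilde2 k f L D))

/-- `ξ(n) = ζ(max {16 h(f(n)) (k + 1)² (6 D + 1), 4 c r₂(n)² (6 D + 1)}, f(n))`. -/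
def smallXi (k : ℕ) (f : ℕ → ℕ) (c : ℕ) (C : ℕ → ℕ) (D : ℕ) (h : ℕ → ℕ) (n : ℕ) : ℕ :=
  zeta c C
    (max (16 * h (f n) * (k + 1) ^ 2 * (6 * D + 1)) (4 * c * (r2 k D n) ^ 2 * (6 * D + 1)))
    (f n)

/-- `Ξ₂(n) = ξ(Φ(n))`. -/
noncomputable def Xi2 (k : ℕ) (f : ℕ → ℕ) (c : ℕ) (C l L : ℕ → ℕ) (D : ℕ) (h : ℕ → ℕ)
    (n : ℕ) : ℕ :=
  smallXi k f c C D h (Phi k c f l L D n)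

/-- `Ξ(n) = max {Ξ₁(n), Ξ₂(n)}`. -/
noncomputable def Xi (k : ℕ) (f : ℕ → ℕ) (c : ℕ) (C l L : ℕ → ℕ) (D : ℕ) (h : ℕ → ℕ)
    (n : ℕ) : ℕ :=
  max (Xi1 k f c C l L D n) (Xi2 k f c C l L D h n)

/-- `w_f[D, f](m) = max {f(24 D (m + 1)²), 24 D (m + 1)²}`. -/
def wFun (D : ℕ) (f : ℕ → ℕ) (m : ℕ) : ℕ :=
  max (f (24 * D * (m + 1) ^ 2)) (24 * D * (m + 1) ^ 2)

/-- `β[D](k, f) = 24 D (w_f^(R) (0) + 1)²` with `R = 4 D⁴ (k + 1)²`. -/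
def beta (D k : ℕ) (f : ℕ → ℕ) : ℕ :=
  24 * D * ((wFun D f)^[4 * D ^ 4 * (k + 1) ^ 2] 0 + 1) ^ 2

/-- `b = β(k̄, Ξ)` with `k̄ = 32 (k + 1)² - 1`. -/
noncomputable def betaXi (k : ℕ) (f : ℕ → ℕ) (c : ℕ) (C l L : ℕ → ℕ) (D : ℕ)
    (h : ℕ → ℕ) : ℕ :=
  beta D (32 * (k + 1) ^ 2 - 1) (Xi k f c C l L D h)

/-- The bound `μ(k, f) = max {σ̄(k, φ₂(r₁(b), r₃(b), f̃ + 2)), Φ(b)}` with `b = β(k̄, Ξ)`. -/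
noncomputable def mu (c : ℕ) (C l L : ℕ → ℕ) (D : ℕ) (h : ℕ → ℕ) (k : ℕ) (f : ℕ → ℕ) : ℕ :=
  max
    (sigmaBar L D k
      (phi2 D (r1 c (betaXi k f c C l L D h)) (r3 k c l D (betaXi k f c C l L D h))
        (fTilde2 k f L D)))
    (Phi k c f l L D (betaXi k f c C l L D h))

end MPPA

/-!
The errors play no role for the exact iteration `y`, and the proof works with `y` alone.

Resolvents exist on the whole space by Minty's theorem. Solving `x ∈ y + σ A y` amounts, by
maximality, to finding a common point of the balls with centre `(a - (σ b - x)) / 2` and radius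
`‖a + (σ b - x)‖ / 2`, for `(a, b)` in the graph of `A`. Monotonicity says that the distance of two
centres is at most that of the vectors `(a + (σ b - x)) / 2`, so that Kirszbraun's one-point
extension `exists_norm_sub_le` applies: for finitely many balls by maximizing a concave quadratic
over a simplex, and in general by weak-star compactness.

Put `J = J_{1/c}`. As in the classical convergence proof, the iteration is compared with the
projection of `u` onto `S`. No rate for that projection is available, so `exists_approx_projection`
supplies a point `x` that is almost fixed by `J` (as precisely as `Ξ` demands) and satisfies
`⟪u - x, v - x⟫ ≤ 1 / (32 (k + 1)²)` for all `v` in the ball with `‖J v - v‖ ≤ 1 / (n₀ + 1)`, where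
`n₀ ≤ β(k̄, Ξ)`. By `stepEstimates`, the numbers `s i = ‖y i - x‖²` satisfy, up to small errors,
`s (i + 1) ≤ (1 - λ_i) s i + 2 λ_i ⟪u - x, y (i + 1) - x⟫` and
`‖y i - J_{c_i} (y i)‖² ≤ c (s i - s (i + 1) + 9/4 D² λ_i)`.

If `s` decreases on the interval from `r₃(n₀)` to `Φ(n₀)`, it is almost constant on a long
subinterval; there the `y i` are almost fixed points, the inner products are small, and the
divergence of `∑ λ_i` drives `s` below `1 / (k + 1)` (`exists_le_of_decreasing`). Otherwise every `i`
after `Φ(n₀)` has a last increase `τ < i` of `s`, beyond `r₃(n₀)`; at `τ` the drop `s τ - s (τ + 1)`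
is negative, so `y τ` is almost fixed, and the recursion divided by `λ_τ` bounds `s (τ + 1) ≥ s i`
(`le_of_increase`).
-/

namespace MPPA

/-! ### One-point extension of nonexpansive maps -/

section Kirszbraun

open Filter Topology

variable {H : Type*} [NormedAddCommGroup H] [InnerProductSpace ℝ H]

theorem sum_mul_norm_sub_sq {ι : Type*} [Fintype ι] (w : ι → ℝ) (hw : ∑ i, w i = 1) (c : ι → H) :
    ∑ i, ∑ j, w i * w j * ‖c i - c j‖ ^ 2
      = 2 * (∑ i, w i * ‖c i‖ ^ 2 - ‖∑ i, w i • c i‖ ^ 2) := by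
  have h1 : ‖∑ i, w i • c i‖ ^ 2 = ∑ i, ∑ j, w i * w j * inner ℝ (c i) (c j) := by
    rw [← real_inner_self_eq_norm_sq, sum_inner]
    refine Finset.sum_congr rfl fun i _ => ?_
    rw [inner_sum]
    refine Finset.sum_congr rfl fun j _ => ?_
    rw [real_inner_smul_left, real_inner_smul_right, mul_assoc]
  have h2 : ∑ i, ∑ j, w i * w j * ‖c i‖ ^ 2 = ∑ i, w i * ‖c i‖ ^ 2 := by
    refine Finset.sum_congr rfl fun i _ => ?_
    rw [← Finset.sum_mul, ← Finset.mul_sum, hw, mul_one]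
  have h3 : ∑ i, ∑ j, w i * w j * ‖c j‖ ^ 2 = ∑ i, w i * ‖c i‖ ^ 2 := by
    rw [Finset.sum_comm, ← h2]
    simp only [mul_comm]
  have h4 : ∀ i j, w i * w j * ‖c i - c j‖ ^ 2 = w i * w j * ‖c i‖ ^ 2
      - 2 * (w i * w j * inner ℝ (c i) (c j)) + w i * w j * ‖c j‖ ^ 2 := fun i j => by
    rw [norm_sub_sq_real]; ring
  simp only [h4, Finset.sum_add_distrib, Finset.sum_sub_distrib, ← Finset.mul_sum, h2, h3, ← h1]
  ring

/-- The finite case of Kirszbraun's one-point extension. The point is `∑ w i • c i` for the weights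
`w` that maximize the dual function `θ`, the minimum over `y` of `∑ w i (‖y - c i‖² - ‖q i‖²)`. -/
theorem exists_norm_sub_le_of_fintype {ι : Type*} [Fintype ι] [Nonempty ι] (c q : ι → H)
    (hcq : ∀ i j, ‖c i - c j‖ ≤ ‖q i - q j‖) : ∃ y : H, ∀ i, ‖y - c i‖ ≤ ‖q i‖ := by
  classical
  let θ : (ι → ℝ) → ℝ := fun w =>
    ∑ i, w i * (‖c i‖ ^ 2 - ‖q i‖ ^ 2) - ‖∑ i, w i • c i‖ ^ 2
  have hθ : Continuous θ := by fun_prop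
  obtain ⟨w, hw, hmax⟩ := (isCompact_stdSimplex (𝕜 := ℝ) ι).exists_isMaxOn
    ⟨_, single_mem_stdSimplex ℝ (Classical.arbitrary ι)⟩ hθ.continuousOn
  obtain ⟨hw0, hw1⟩ := hw
  set Y : H := ∑ i, w i • c i with hY
  set Λ : ℝ := ∑ i, w i * (‖c i‖ ^ 2 - ‖q i‖ ^ 2) with hΛ
  -- the maximal value `θ w` is at most `-‖∑ w i • q i‖²`
  have hneg : Λ - ‖Y‖ ^ 2 ≤ 0 := by
    have h1 := sum_mul_norm_sub_sq w hw1 c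
    have h2 := sum_mul_norm_sub_sq w hw1 q
    have h3 : ∑ i, ∑ j, w i * w j * ‖c i - c j‖ ^ 2 ≤ ∑ i, ∑ j, w i * w j * ‖q i - q j‖ ^ 2 := by
      gcongr with i _ j _
      · exact mul_nonneg (hw0 i) (hw0 j)
      · exact hcq i j
    have h4 : Λ = ∑ i, w i * ‖c i‖ ^ 2 - ∑ i, w i * ‖q i‖ ^ 2 := by
      simp only [hΛ, mul_sub, Finset.sum_sub_distrib]
    have h5 := sq_nonneg ‖∑ i, w i • q i‖
    rw [← hY] at h1
    linarith
  refine ⟨Y, fun i => ?_⟩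
  set a : ℝ := ‖c i‖ ^ 2 - ‖q i‖ ^ 2 with ha
  -- optimality of `w` in the direction of the `i`-th vertex of the simplex
  have hvar : ∀ t : ℝ, 0 < t → t ≤ 1 →
      a - Λ - 2 * inner ℝ Y (c i - Y) ≤ t * ‖c i - Y‖ ^ 2 := by
    intro t ht ht1
    have hmem : (1 - t) • w + t • Pi.single i 1 ∈ stdSimplex ℝ ι :=
      convex_stdSimplex ℝ ι ⟨hw0, hw1⟩ (single_mem_stdSimplex ℝ i) (by linarith) ht.le (by ring)
    have h := hmax hmem
    have e1 : ∑ j, ((1 - t) • w + t • (Pi.single i 1 : ι → ℝ)) j • c j = Y + t • (c i - Y) := by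
      simp only [Pi.add_apply, Pi.smul_apply, smul_eq_mul, add_smul, mul_smul,
        Finset.sum_add_distrib, ← Finset.smul_sum, ← hY, Pi.single_apply, ite_smul, one_smul,
        zero_smul, Finset.sum_ite_eq', Finset.mem_univ, if_true]
      module
    have e2 : ∑ j, ((1 - t) • w + t • (Pi.single i 1 : ι → ℝ)) j * (‖c j‖ ^ 2 - ‖q j‖ ^ 2)
        = Λ + t * (a - Λ) := by
      simp only [Pi.add_apply, Pi.smul_apply, smul_eq_mul, add_mul, mul_assoc,
        Finset.sum_add_distrib, ← Finset.mul_sum, ← hΛ, Pi.single_apply, ite_mul, one_mul,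
        zero_mul, Finset.sum_ite_eq', Finset.mem_univ, if_true]
      ring
    have h' : Λ + t * (a - Λ) - ‖Y + t • (c i - Y)‖ ^ 2 ≤ Λ - ‖Y‖ ^ 2 := by
      rw [← e1, ← e2]; exact h
    rw [norm_add_sq_real, real_inner_smul_right, norm_smul, Real.norm_of_nonneg ht.le] at h'
    refine le_of_mul_le_mul_left (a := t) ?_ ht
    linarith
  have hle : a - Λ - 2 * inner ℝ Y (c i - Y) ≤ 0 := by
    have htend : Tendsto (fun t : ℝ => t * ‖c i - Y‖ ^ 2) (𝓝[>] 0) (𝓝 0) := by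
      have : Continuous fun t : ℝ => t * ‖c i - Y‖ ^ 2 := by fun_prop
      simpa using (this.tendsto 0).mono_left nhdsWithin_le_nhds
    refine ge_of_tendsto htend ?_
    filter_upwards [Ioc_mem_nhdsGT (zero_lt_one' ℝ)] with t ht using hvar t ht.1 ht.2
  rw [inner_sub_right, real_inner_self_eq_norm_sq] at hle
  refine abs_le_of_sq_le_sq' ?_ (norm_nonneg _) |>.2
  rw [norm_sub_sq_real]
  linarith

/-- Kirszbraun's one-point extension: if `q i ↦ c i` is nonexpansive, it extends nonexpansively to
the point `0`. -/
theorem exists_norm_sub_le [CompleteSpace H] {ι : Type*} (c q : ι → H)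
    (hcq : ∀ i j, ‖c i - c j‖ ≤ ‖q i - q j‖) : ∃ y : H, ∀ i, ‖y - c i‖ ≤ ‖q i‖ := by
  rcases isEmpty_or_nonempty ι with hι | ⟨⟨i₀⟩⟩
  · exact ⟨0, fun i => (hι.false i).elim⟩
  let K : ι → Set (WeakDual ℝ H) := fun i =>
    WeakDual.toStrongDual ⁻¹' Metric.closedBall (InnerProductSpace.toDual ℝ H (c i)) ‖q i‖
  have hmem : ∀ (y : H) (i : ι), ‖y - c i‖ ≤ ‖q i‖ ↔
      StrongDual.toWeakDual (InnerProductSpace.toDual ℝ H y) ∈ K i := by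
    intro y i
    change _ ↔ dist (InnerProductSpace.toDual ℝ H y) (InnerProductSpace.toDual ℝ H (c i)) ≤ _
    rw [LinearIsometryEquiv.dist_map, dist_eq_norm]
  obtain ⟨φ, -, hφ⟩ := (WeakDual.isCompact_closedBall
    (InnerProductSpace.toDual ℝ H (c i₀)) ‖q i₀‖).inter_iInter_nonempty K
    (fun i => WeakDual.isClosed_closedBall _ _) (by
      intro s
      classical
      have : Nonempty (insert i₀ s : Finset ι) := ⟨⟨i₀, Finset.mem_insert_self _ _⟩⟩
      obtain ⟨y, hy⟩ := exists_norm_sub_le_of_fintype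
        (fun i : (insert i₀ s : Finset ι) => c i) (fun i => q i) (fun i j => hcq i j)
      refine ⟨StrongDual.toWeakDual (InnerProductSpace.toDual ℝ H y), ?_, ?_⟩
      · exact (hmem y i₀).1 (hy ⟨i₀, Finset.mem_insert_self _ _⟩)
      · exact Set.mem_iInter₂.2 fun i hi => (hmem y i).1 (hy ⟨i, Finset.mem_insert_of_mem hi⟩))
  refine ⟨(InnerProductSpace.toDual ℝ H).symm (WeakDual.toStrongDual φ), fun i => ?_⟩
  rw [hmem, LinearIsometryEquiv.apply_symm_apply]
  exact Set.mem_iInter.1 hφ i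

end Kirszbraun

/-! ### Minty's theorem and resolvents -/

section Resolvent

variable {H : Type*} [NormedAddCommGroup H] [InnerProductSpace ℝ H] {A : H → Set H}

theorem IsMaximalMonotoneOp.mem_of_forall (hA : IsMaximalMonotoneOp A) {y v : H}
    (h : ∀ a, ∀ b ∈ A a, 0 ≤ inner ℝ (a - y) (b - v)) : v ∈ A y := by
  have hB := hA.2 (fun a => {b | b ∈ A a ∨ a = y ∧ b = v}) (by
    rintro a a' b b' (hb | ⟨rfl, rfl⟩) (hb' | ⟨rfl, rfl⟩)
    · exact hA.1 _ _ _ _ hb hb'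
    · exact h _ _ hb
    · rw [← neg_sub a', ← neg_sub b', inner_neg_neg]
      exact h _ _ hb'
    · simp) (fun a b hb => Or.inl hb)
  rw [← hB]
  exact Or.inr ⟨rfl, rfl⟩

/-- Minty's theorem: `I + σ A` is surjective. -/
theorem IsMaximalMonotoneOp.exists_add_smul_eq [CompleteSpace H] (hA : IsMaximalMonotoneOp A)
    {σ : ℝ} (hσ : 0 < σ) (x : H) : ∃ y, ∃ v ∈ A y, y + σ • v = x := by
  obtain ⟨y, hy⟩ := exists_norm_sub_le
    (fun g : {g : H × H // g.2 ∈ A g.1} => (2⁻¹ : ℝ) • (g.1.1 - (σ • g.1.2 - x)))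
    (fun g => (2⁻¹ : ℝ) • (g.1.1 + (σ • g.1.2 - x))) (by
      rintro ⟨⟨a, b⟩, hb⟩ ⟨⟨a', b'⟩, hb'⟩
      have hm := hA.1 a a' b b' hb hb'
      rw [← smul_sub, ← smul_sub, norm_smul, norm_smul]
      refine mul_le_mul_of_nonneg_left (abs_le_of_sq_le_sq' ?_ (norm_nonneg _)).2 (norm_nonneg _)
      have e1 : a - (σ • b - x) - (a' - (σ • b' - x)) = (a - a') - σ • (b - b') := by module
      have e2 : a + (σ • b - x) - (a' + (σ • b' - x)) = (a - a') + σ • (b - b') := by module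
      dsimp only
      rw [e1, e2, norm_sub_sq_real, norm_add_sq_real, real_inner_smul_right]
      linarith [mul_nonneg hσ.le hm])
  have hσ' := hσ.ne'
  refine ⟨y, σ⁻¹ • (x - y), hA.mem_of_forall fun a b hb => ?_, by simp [smul_smul, hσ']⟩
  have h := hy ⟨(a, b), hb⟩
  dsimp only at h
  have h2 : ‖y - (2⁻¹ : ℝ) • (a - (σ • b - x))‖ ^ 2 ≤ ‖(2⁻¹ : ℝ) • (a + (σ • b - x))‖ ^ 2 := by
    gcongr
  have e : (4 : ℝ) * inner ℝ (a - y) (σ • (b - σ⁻¹ • (x - y)))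
      = 4 * (‖(2⁻¹ : ℝ) • (a + (σ • b - x))‖ ^ 2 - ‖y - (2⁻¹ : ℝ) • (a - (σ • b - x))‖ ^ 2) := by
    have e0 : σ • (b - σ⁻¹ • (x - y)) = (σ • b - x) + y := by
      rw [smul_sub, smul_smul, mul_inv_cancel₀ hσ', one_smul]; abel
    rw [e0]
    generalize σ • b - x = d
    rw [norm_smul, norm_sub_sq_real, norm_smul, mul_pow, mul_pow, norm_add_sq_real,
      norm_sub_sq_real, real_inner_smul_right, inner_sub_left, inner_sub_right, inner_add_right,
      inner_add_right, real_inner_self_eq_norm_sq, real_inner_comm y a]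
    norm_num
    ring
  rw [real_inner_smul_right] at e
  have : 0 ≤ σ * inner ℝ (a - y) (b - σ⁻¹ • (x - y)) := by linarith
  exact nonneg_of_mul_nonneg_right this hσ

theorem IsMaximalMonotoneOp.resolvent_spec [CompleteSpace H] (hA : IsMaximalMonotoneOp A)
    {σ : ℝ} (hσ : 0 < σ) (x : H) : σ⁻¹ • (x - resolvent A σ x) ∈ A (resolvent A σ x) := by
  obtain ⟨v, hv, h⟩ := Classical.epsilon_spec (hA.exists_add_smul_eq hσ x)
  have : σ⁻¹ • (x - resolvent A σ x) = v := by
    change resolvent A σ x + σ • v = x at h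
    rw [← eq_sub_iff_add_eq'] at h
    rw [← h, smul_smul, inv_mul_cancel₀ hσ.ne', one_smul]
  rw [this]
  exact hv

variable [CompleteSpace H]

theorem IsMaximalMonotoneOp.inner_resolvent_sub_nonneg (hA : IsMaximalMonotoneOp A)
    {σ : ℝ} (hσ : 0 < σ) (x y : H) :
    0 ≤ inner ℝ (resolvent A σ x - resolvent A σ y)
      ((x - resolvent A σ x) - (y - resolvent A σ y)) := by
  have h := hA.1 _ _ _ _ (hA.resolvent_spec hσ x) (hA.resolvent_spec hσ y)
  rw [← smul_sub, real_inner_smul_right] at h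
  exact nonneg_of_mul_nonneg_right h (inv_pos.2 hσ)

/-- Resolvents are firmly nonexpansive. -/
theorem IsMaximalMonotoneOp.norm_resolvent_sub_sq_le (hA : IsMaximalMonotoneOp A)
    {σ : ℝ} (hσ : 0 < σ) (x y : H) :
    ‖resolvent A σ x - resolvent A σ y‖ ^ 2 +
      ‖(x - resolvent A σ x) - (y - resolvent A σ y)‖ ^ 2 ≤ ‖x - y‖ ^ 2 := by
  have h := hA.inner_resolvent_sub_nonneg hσ x y
  have e : x - y = (resolvent A σ x - resolvent A σ y) +
    ((x - resolvent A σ x) - (y - resolvent A σ y)) := by abel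
  rw [e, norm_add_sq_real]
  linarith

theorem IsMaximalMonotoneOp.norm_resolvent_sub_le (hA : IsMaximalMonotoneOp A)
    {σ : ℝ} (hσ : 0 < σ) (x y : H) :
    ‖resolvent A σ x - resolvent A σ y‖ ≤ ‖x - y‖ := by
  refine (abs_le_of_sq_le_sq' ?_ (norm_nonneg _)).2
  linarith [hA.norm_resolvent_sub_sq_le hσ x y,
    sq_nonneg ‖(x - resolvent A σ x) - (y - resolvent A σ y)‖]

theorem IsMaximalMonotoneOp.resolvent_eq_self (hA : IsMaximalMonotoneOp A)
    {σ : ℝ} (hσ : 0 < σ) {p : H} (hp : p ∈ zeros A) :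
    resolvent A σ p = p := by
  have h := hA.1 _ _ _ _ (hA.resolvent_spec hσ p) hp
  rw [sub_zero, real_inner_smul_right, ← neg_sub p, inner_neg_left, real_inner_self_eq_norm_sq]
    at h
  have h2 := nonneg_of_mul_nonneg_right h (inv_pos.2 hσ)
  have h3 : ‖p - resolvent A σ p‖ = 0 := by
    nlinarith [norm_nonneg (p - resolvent A σ p)]
  exact (sub_eq_zero.1 (norm_eq_zero.1 h3)).symm

/-- Along `σ`, the displacement `‖x - J_σ x‖` is nondecreasing and `‖x - J_σ x‖ / σ` is
nonincreasing. -/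
theorem IsMaximalMonotoneOp.norm_sub_resolvent_mono (hA : IsMaximalMonotoneOp A)
    {a b : ℝ} (ha : 0 < a) (hab : a ≤ b) (x : H) :
    ‖x - resolvent A a x‖ ≤ ‖x - resolvent A b x‖ ∧
      ‖x - resolvent A b x‖ ≤ b / a * ‖x - resolvent A a x‖ := by
  have hb : 0 < b := ha.trans_le hab
  have h := hA.1 _ _ _ _ (hA.resolvent_spec ha x) (hA.resolvent_spec hb x)
  obtain ⟨v, hv⟩ : ∃ v, v = a⁻¹ • (x - resolvent A a x) := ⟨_, rfl⟩
  obtain ⟨w, hw⟩ : ∃ w, w = b⁻¹ • (x - resolvent A b x) := ⟨_, rfl⟩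
  rw [← hv, ← hw] at h
  have e1 : x - resolvent A a x = a • v := by rw [hv, smul_smul, mul_inv_cancel₀ ha.ne', one_smul]
  have e2 : x - resolvent A b x = b • w := by rw [hw, smul_smul, mul_inv_cancel₀ hb.ne', one_smul]
  have e3 : resolvent A a x - resolvent A b x = b • w - a • v := by rw [← e1, ← e2]; abel
  rw [e3, inner_sub_left, inner_sub_right, inner_sub_right, real_inner_smul_left,
    real_inner_smul_left, real_inner_smul_left, real_inner_smul_left, real_inner_self_eq_norm_sq,
    real_inner_self_eq_norm_sq, real_inner_comm v w] at h
  rw [e1, e2, norm_smul, norm_smul, Real.norm_of_nonneg ha.le, Real.norm_of_nonneg hb.le]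
  have hcs := real_inner_le_norm v w
  have hP := norm_nonneg v
  have hQ := norm_nonneg w
  have key : (‖v‖ - ‖w‖) * (a * ‖v‖ - b * ‖w‖) ≤ 0 := by nlinarith
  have hwv : ‖w‖ ≤ ‖v‖ := by
    by_contra! hlt
    have h1 : a * ‖v‖ < b * ‖w‖ := by nlinarith
    nlinarith
  constructor
  · rcases hwv.eq_or_lt with heq | hlt
    · rw [heq]; gcongr
    · by_contra! h1
      nlinarith
  · rw [← mul_assoc, div_mul_cancel₀ _ ha.ne']
    gcongr

end Resolvent

/-! ### Metastable descent and recursive inequalities -/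

section Descent

/-- Descending from `a`, where `F 0, F 1, …` are ever stricter requirements: among the first `R`
iterates `m` of `w` there is one for which some `x ∈ F (w m)` almost minimizes `φ` on `F m`. -/
theorem exists_forall_le_add_of_iterate {α : Type*} (F : ℕ → Set α) (φ : α → ℝ) (hφ : ∀ x, 0 ≤ φ x)
    (w : ℕ → ℕ) {a : α} (ha : ∀ n, a ∈ F n) {ε : ℝ} {R : ℕ} (hR : φ a < R * ε) :
    ∃ i < R, ∃ x ∈ F (w (w^[i] 0)), ∀ y ∈ F (w^[i] 0), φ x ≤ φ y + ε := by
  by_contra! hcon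
  have key : ∀ j ≤ R, ∃ x ∈ F (w^[R - j] 0), φ x ≤ φ a - j * ε := by
    intro j
    induction j with
    | zero => exact fun _ => ⟨a, ha _, by simp⟩
    | succ j ih =>
      intro hj
      obtain ⟨x, hx, hxa⟩ := ih (by omega)
      have e : R - j = (R - (j + 1)) + 1 := by omega
      rw [e, Function.iterate_succ_apply'] at hx
      obtain ⟨y, hy, hxy⟩ := hcon _ (by omega) x hx
      refine ⟨y, hy, ?_⟩
      push_cast
      linarith
  obtain ⟨x, -, hx⟩ := key R le_rfl
  linarith [hφ x]

/-- Metastability of a bounded sequence: along the iterates of `g` it cannot drop by more than `η`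
in each of `R` steps. -/
theorem exists_iterate_sub_le (s : ℕ → ℝ) (g : ℕ → ℕ) (a : ℕ) {M η : ℝ} {R : ℕ}
    (hs : ∀ n, 0 ≤ s n) (hM : s a ≤ M) (hMR : M ≤ R * η) (hR : R ≠ 0) :
    ∃ j < R, s (g^[j] a) - s (g^[j + 1] a) ≤ η := by
  by_contra! hcon
  have h1 : ∑ j ∈ Finset.range R, η < ∑ j ∈ Finset.range R, (s (g^[j] a) - s (g^[j + 1] a)) :=
    Finset.sum_lt_sum_of_nonempty (by simpa using hR) fun j hj => hcon j (Finset.mem_range.1 hj)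
  rw [Finset.sum_range_sub' (fun j => s (g^[j] a))] at h1
  simp only [Finset.sum_const, Finset.card_range, nsmul_eq_mul, Function.iterate_zero, id] at h1
  linarith [hs (g^[R] a)]

/-- Iterating a monotone `g` gives a sequence that is monotone or antitone, according to whether
`a ≤ g a`; in either case the maximum with the starting point grows along the iteration. -/
theorem iterate_le_max_iterate {g : ℕ → ℕ} (hg : Monotone g) (a : ℕ) {i j : ℕ} (hij : i ≤ j) :
    g^[i] a ≤ max a (g^[j] a) := by
  rcases le_total a (g a) with h | h
  · exact (hg.monotone_iterate_of_le_map h hij).trans (le_max_right _ _)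
  · exact (hg.antitone_iterate_of_map_le h (Nat.zero_le i)).trans (le_max_left _ _)

theorem phi2_mono {g : ℕ → ℕ} (hg : Monotone g) (D : ℕ) {m m' n n' : ℕ} (hm : m ≤ m')
    (hn : n ≤ n') : phi2 D m n g ≤ phi2 D m' n' g := by
  have h1 : 4 * D ^ 2 * (m + 1) ≤ 4 * D ^ 2 * (m' + 1) := by gcongr
  refine max_le (hn.trans (le_max_left _ _)) ?_
  exact (hg.iterate _ hn).trans (iterate_le_max_iterate hg _ h1)

/-- The quantitative form of the fact that `s (i + 1) ≤ (1 - λ i) s i + λ i B` and `∑ λ i = ∞` force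
`limsup s ≤ B`, with a constant error `η` in every step. -/
theorem le_exp_neg_sum_mul_add (s lam : ℕ → ℝ) (hlam0 : ∀ i, 0 ≤ lam i) (hlam1 : ∀ i, lam i ≤ 1)
    {M B η : ℝ} (hM : 0 ≤ M) (hη : 0 ≤ η) (hB : 0 ≤ B) {a m : ℕ} (ham : a ≤ m) (hsa : s a ≤ M)
    (hs : ∀ i, a ≤ i → i < m → s (i + 1) ≤ (1 - lam i) * s i + lam i * B + η) :
    s m ≤ Real.exp (-∑ i ∈ Finset.Ico a m, lam i) * M + B + (m - a : ℕ) * η := by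
  induction m, ham using Nat.le_induction with
  | base => simp; linarith
  | succ m ham ih =>
    have h1 := ih fun i hi him => hs i hi (by omega)
    have h2 := hs m ham (by omega)
    have h3 : (1 - lam m) * s m ≤ (1 - lam m) *
        (Real.exp (-∑ i ∈ Finset.Ico a m, lam i) * M + B + (m - a : ℕ) * η) :=
      mul_le_mul_of_nonneg_left h1 (by linarith [hlam1 m])
    rw [Finset.sum_Ico_succ_top ham, neg_add, Real.exp_add]
    have h4 : (1 - lam m) * (Real.exp (-∑ i ∈ Finset.Ico a m, lam i) * M) ≤
        Real.exp (-lam m) * (Real.exp (-∑ i ∈ Finset.Ico a m, lam i) * M) := by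
      gcongr
      linarith [Real.add_one_le_exp (-lam m)]
    have h5 : (1 - lam m) * ((m - a : ℕ) * η) ≤ 1 * ((m - a : ℕ) * η) := by
      gcongr
      linarith [hlam0 m]
    have e : ((m + 1 - a : ℕ) : ℝ) = (m - a : ℕ) + 1 := by
      rw [Nat.sub_add_comm ham]; push_cast; ring
    rw [e]
    linarith

end Descent

/-! ### Approximate projection onto a fixed point set -/

section Nonexpansive

variable {H : Type*} [NormedAddCommGroup H] [InnerProductSpace ℝ H]

/-- Points of a segment between two approximate fixed points of a nonexpansive map are approximate
fixed points, with the error enlarged to the order of its square root. -/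
theorem norm_map_sub_self_sq_le {J : H → H} (hJ : ∀ x y, ‖J x - J y‖ ≤ ‖x - y‖) {x y : H}
    {d δ t : ℝ} (hδ : 0 ≤ δ) (ht0 : 0 ≤ t) (ht1 : t ≤ 1) (hxy : ‖x - y‖ ≤ d)
    (hx : ‖J x - x‖ ≤ δ) (hy : ‖J y - y‖ ≤ δ) :
    ‖J (x + t • (y - x)) - (x + t • (y - x))‖ ^ 2 ≤ d * δ + δ ^ 2 := by
  set w := x + t • (y - x) with hw
  have h1 : ‖J w - x‖ ≤ t * ‖x - y‖ + δ := by
    have e : w - x = t • (y - x) := by rw [hw]; abel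
    have := hJ w x
    rw [e, norm_smul, Real.norm_of_nonneg ht0, norm_sub_rev y x] at this
    calc ‖J w - x‖ = ‖(J w - J x) + (J x - x)‖ := by congr 1; abel
      _ ≤ _ := (norm_add_le _ _).trans (add_le_add this hx)
  have h2 : ‖J w - y‖ ≤ (1 - t) * ‖x - y‖ + δ := by
    have e : w - y = (1 - t) • (x - y) := by rw [hw]; module
    have := hJ w y
    rw [e, norm_smul, Real.norm_of_nonneg (by linarith)] at this
    calc ‖J w - y‖ = ‖(J w - J y) + (J y - y)‖ := by congr 1; abel
      _ ≤ _ := (norm_add_le _ _).trans (add_le_add this hy)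
  have e3 : ‖J w - w‖ ^ 2 = (1 - t) * ‖J w - x‖ ^ 2 + t * ‖J w - y‖ ^ 2
      - t * (1 - t) * ‖x - y‖ ^ 2 := by
    have ea : J w - w = (1 - t) • (J w - x) + t • (J w - y) := by
      generalize J w = v
      rw [hw]; module
    have eb : x - y = (J w - y) - (J w - x) := by abel
    rw [ea, eb, norm_add_sq_real, norm_sub_sq_real (J w - y), norm_smul, norm_smul, mul_pow, mul_pow,
      real_inner_smul_left, real_inner_smul_right, Real.norm_eq_abs, Real.norm_eq_abs, sq_abs,
      sq_abs, real_inner_comm (J w - x)]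
    ring
  have h1' : ‖J w - x‖ ^ 2 ≤ (t * ‖x - y‖ + δ) ^ 2 := by gcongr
  have h2' : ‖J w - y‖ ^ 2 ≤ ((1 - t) * ‖x - y‖ + δ) ^ 2 := by gcongr
  have h1'' := mul_le_mul_of_nonneg_left h1' (sub_nonneg.2 ht1)
  have h2'' := mul_le_mul_of_nonneg_left h2' ht0
  have h4 : 4 * (t * (1 - t)) * (‖x - y‖ * δ) ≤ 1 * (d * δ) := by
    gcongr
    nlinarith [sq_nonneg (2 * t - 1)]
  rw [e3]
  linarith

/-- An approximate version of the projection of `u` onto the fixed points of `J`, together with its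
variational characterization. -/
theorem exists_approx_projection {J : H → H} (hJ : ∀ x y, ‖J x - J y‖ ≤ ‖x - y‖) {p u : H}
    (hp : J p = p) {D : ℕ} (hD : D ≠ 0) (hu : ‖u - p‖ ≤ D / 2) (k : ℕ) (f : ℕ → ℕ) :
    ∃ n ≤ beta D k f, ∃ x, ‖x - p‖ ≤ D ∧ ‖J x - x‖ ≤ 1 / ((f n : ℝ) + 1) ∧
      ∀ y, ‖y - p‖ ≤ D → ‖J y - y‖ ≤ 1 / ((n : ℝ) + 1) →
        inner ℝ (u - x) (y - x) ≤ 1 / ((k : ℝ) + 1) := by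
  have hD1 : (1 : ℝ) ≤ D := by exact_mod_cast Nat.one_le_iff_ne_zero.2 hD
  set K : ℝ := (k : ℝ) + 1 with hK
  have hK1 : 1 ≤ K := by rw [hK]; linarith [Nat.cast_nonneg (α := ℝ) k]
  obtain ⟨i, hi, x, ⟨hxp, hxJ⟩, hmin⟩ := exists_forall_le_add_of_iterate
    (fun n => {x : H | ‖x - p‖ ≤ D ∧ ‖J x - x‖ ≤ 1 / ((n : ℝ) + 1)}) (fun x => ‖x - u‖ ^ 2)
    (fun x => sq_nonneg _) (wFun D f) (a := p) (ε := 1 / (4 * D ^ 2 * K ^ 2))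
    (R := 4 * D ^ 4 * (k + 1) ^ 2)
    (fun n => ⟨by simp, by simp [hp]; positivity⟩) (by
      have e : ((4 * D ^ 4 * (k + 1) ^ 2 : ℕ) : ℝ) * (1 / (4 * D ^ 2 * K ^ 2)) = (D : ℝ) ^ 2 := by
        push_cast; rw [← hK]; field_simp
      rw [e, norm_sub_rev]
      have : ‖u - p‖ ^ 2 ≤ ((D : ℝ) / 2) ^ 2 := by gcongr
      nlinarith)
  set m := (wFun D f)^[i] 0 with hm
  have hw : ∀ n, n ≤ wFun D f n := fun n => by
    have : n ≤ 24 * D * (n + 1) ^ 2 := by nlinarith [Nat.one_le_iff_ne_zero.2 hD, sq_nonneg n]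
    exact this.trans (le_max_right _ _)
  have hmono : ∀ a b : ℕ, a ≤ b → (1 : ℝ) / ((b : ℝ) + 1) ≤ 1 / ((a : ℝ) + 1) := fun a b h => by
    gcongr
  refine ⟨24 * D * (m + 1) ^ 2, ?_, x, hxp,
    hxJ.trans (hmono _ _ (le_max_left _ _)), fun y hyp hyJ => ?_⟩
  · have : m ≤ (wFun D f)^[4 * D ^ 4 * (k + 1) ^ 2] 0 :=
      Function.monotone_iterate_of_id_le (f := wFun D f) hw hi.le 0
    unfold beta
    gcongr
  have hxJ' := hxJ.trans (hmono _ _ (le_max_right (f (24 * D * (m + 1) ^ 2)) _))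
  set δ : ℝ := 1 / (((24 * D * (m + 1) ^ 2 : ℕ) : ℝ) + 1) with hδ
  have hδ0 : 0 ≤ δ := by positivity
  have hd : ‖x - y‖ ≤ 2 * D := by
    calc ‖x - y‖ = ‖(x - p) - (y - p)‖ := by congr 1; abel
      _ ≤ _ := (norm_sub_le _ _).trans (by linarith)
  -- compare `x` with the point at parameter `t` on the segment from `x` to `y`; this `t` balances the
  -- quadratic term `t (2 D)² / 2` against `ε / (2 t)` for the tolerance `ε` of the minimality of `x`
  set t : ℝ := 1 / (4 * D ^ 2 * K) with ht
  have ht0 : 0 < t := by positivity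
  have ht1 : t ≤ 1 := by
    rw [ht, div_le_one (by positivity)]
    nlinarith [mul_le_mul hD1 hD1 zero_le_one (by linarith)]
  have hM : (0 : ℝ) < (m : ℝ) + 1 := by positivity
  have hJw : ‖J (x + t • (y - x)) - (x + t • (y - x))‖ ≤ 1 / ((m : ℝ) + 1) := by
    refine (abs_le_of_sq_le_sq' ((norm_map_sub_self_sq_le hJ hδ0 ht0.le ht1 hd hxJ' hyJ).trans ?_)
      (by positivity)).2
    have h1 : δ ≤ 1 / (24 * D * ((m : ℝ) + 1) ^ 2) := by
      rw [hδ]; push_cast; gcongr; linarith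
    have h2 : δ ≤ 1 := by
      rw [hδ, div_le_one (by positivity)]; linarith [Nat.cast_nonneg (α := ℝ) (24 * D * (m + 1) ^ 2)]
    calc 2 * D * δ + δ ^ 2 ≤ 3 * D * δ := by nlinarith
      _ ≤ 3 * D * (1 / (24 * D * ((m : ℝ) + 1) ^ 2)) := by gcongr
      _ = 1 / 8 * (1 / ((m : ℝ) + 1)) ^ 2 := by field_simp; norm_num
      _ ≤ _ := by linarith [sq_nonneg (1 / ((m : ℝ) + 1))]
  have hwp : ‖x + t • (y - x) - p‖ ≤ D := by
    have e : x + t • (y - x) - p = (1 - t) • (x - p) + t • (y - p) := by module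
    rw [e]
    refine (norm_add_le _ _).trans ?_
    rw [norm_smul, norm_smul, Real.norm_of_nonneg ht0.le, Real.norm_of_nonneg (by linarith)]
    nlinarith
  have h := hmin _ ⟨hwp, hJw⟩
  have e : x + t • (y - x) - u = (x - u) + t • (y - x) := by abel
  rw [e, norm_add_sq_real, real_inner_smul_right, norm_smul, Real.norm_of_nonneg ht0.le,
    ← neg_sub u x, inner_neg_left, mul_pow, norm_sub_rev y x] at h
  have h2 : ‖x - y‖ ^ 2 ≤ (2 * D) ^ 2 := by gcongr
  have h3 : 2 * (t * inner ℝ (u - x) (y - x)) ≤ t ^ 2 * (2 * D) ^ 2 + 1 / (4 * D ^ 2 * K ^ 2) := by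
    linarith [mul_le_mul_of_nonneg_left h2 (sq_nonneg t)]
  refine le_of_mul_le_mul_left (a := 2 * t) ?_ (by positivity)
  calc 2 * t * inner ℝ (u - x) (y - x) ≤ t ^ 2 * (2 * D) ^ 2 + 1 / (4 * D ^ 2 * K ^ 2) := by linarith
    _ = 2 * t * (1 / K) := by rw [ht]; field_simp; norm_num

end Nonexpansive

/-! ### One step of the iteration -/

section Step

variable {H : Type*} [NormedAddCommGroup H] [InnerProductSpace ℝ H]

theorem norm_convexComb_sq_le {α β γ : ℝ} (hα : 0 ≤ α) (hβ : 0 ≤ β) (hγ : 0 ≤ γ)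
    (h : α + β + γ = 1) (a b c : H) :
    ‖α • a + β • b + γ • c‖ ^ 2 ≤ α * ‖a‖ ^ 2 + β * ‖b‖ ^ 2 + γ * ‖c‖ ^ 2 := by
  have h1 : ‖α • a + β • b + γ • c‖ ≤ α * ‖a‖ + β * ‖b‖ + γ * ‖c‖ := by
    refine (norm_add₃_le).trans_eq ?_
    rw [norm_smul, norm_smul, norm_smul, Real.norm_of_nonneg hα, Real.norm_of_nonneg hβ,
      Real.norm_of_nonneg hγ]
  have h2 : ‖α • a + β • b + γ • c‖ ^ 2 ≤ (α * ‖a‖ + β * ‖b‖ + γ * ‖c‖) ^ 2 := by gcongr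
  have hα' : α = 1 - β - γ := by linarith
  have := mul_nonneg (mul_nonneg hα hβ) (sq_nonneg (‖a‖ - ‖b‖))
  have := mul_nonneg (mul_nonneg hα hγ) (sq_nonneg (‖a‖ - ‖c‖))
  have := mul_nonneg (mul_nonneg hβ hγ) (sq_nonneg (‖b‖ - ‖c‖))
  have e : α * ‖a‖ ^ 2 + β * ‖b‖ ^ 2 + γ * ‖c‖ ^ 2 - (α * ‖a‖ + β * ‖b‖ + γ * ‖c‖) ^ 2
      = α * β * (‖a‖ - ‖b‖) ^ 2 + α * γ * (‖a‖ - ‖c‖) ^ 2 + β * γ * (‖b‖ - ‖c‖) ^ 2 := by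
    rw [hα']; ring
  linarith

variable {lam gam del : ℝ}

/-- The recursion for the squared distance of the iterates to an almost fixed point `x`. -/
theorem norm_step_sub_sq_le (hlam : 0 ≤ lam) (hgam : 0 ≤ gam) (hdel : 0 ≤ del)
    (hsum : lam + gam + del = 1) {J : H → H} {u x y y' : H}
    (hJ : ‖J y - J x‖ ≤ ‖y - x‖) (hy' : y' = lam • u + gam • y + del • J y) {D ε : ℝ}
    (hε1 : ε ≤ 1) (hx : ‖x - J x‖ ≤ ε) (hyx : ‖y - x‖ ≤ 2 * D) :
    ‖y' - x‖ ^ 2 ≤ (1 - lam) * ‖y - x‖ ^ 2 + 2 * lam * inner ℝ (u - x) (y' - x)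
      + (4 * D + 1) * ε := by
  have hε : 0 ≤ ε := (norm_nonneg _).trans hx
  set d := ‖y - x‖ with hd
  have hd0 : 0 ≤ d := norm_nonneg _
  set v := gam • (y - x) + del • (J y - x) with hv
  have hJx : ‖J y - x‖ ≤ d + ε := by
    calc ‖J y - x‖ = ‖(J y - J x) - (x - J x)‖ := by congr 1; abel
      _ ≤ _ := (norm_sub_le _ _).trans (add_le_add hJ hx)
  have hvn : ‖v‖ ≤ (1 - lam) * d + ε := by
    have h1 : ‖v‖ ≤ gam * d + del * (d + ε) := by
      refine (norm_add_le _ _).trans ?_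
      rw [norm_smul, norm_smul, Real.norm_of_nonneg hgam, Real.norm_of_nonneg hdel]
      gcongr
    have h2 : del * ε ≤ 1 * ε := by gcongr; linarith
    have e : gam = 1 - lam - del := by linarith
    rw [e] at h1
    linarith
  have hv2 : ‖v‖ ^ 2 ≤ ((1 - lam) * d + ε) ^ 2 := by gcongr
  have e : v = (y' - x) - lam • (u - x) := by
    have e1 : lam = 1 - gam - del := by linarith
    rw [hv, hy', e1]; module
  rw [e, norm_sub_sq_real, real_inner_smul_right, real_inner_comm] at hv2
  have h1 : 0 ≤ 1 - lam := by linarith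
  have h2 : (1 - lam) ^ 2 * d ^ 2 ≤ (1 - lam) * d ^ 2 := by
    gcongr; nlinarith
  have h3 : (1 - lam) * (d * ε) ≤ 1 * (2 * D * ε) := by
    gcongr; linarith
  nlinarith [sq_nonneg ‖lam • (u - x)‖]

/-- Firm nonexpansiveness bounds the displacement `‖y - J y‖` by the drop of the squared distance
to `x`. This is needed because `gam`, and hence the term with `gam * del` that a merely nonexpansive
`J` would give, may vanish. -/
theorem mul_norm_sub_map_sq_le (hlam : 0 ≤ lam) (hgam : 0 ≤ gam) (hdel : 0 ≤ del)
    (hsum : lam + gam + del = 1) {J : H → H} {u x y y' : H}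
    (hJ : ‖J y - J x‖ ^ 2 + ‖(y - J y) - (x - J x)‖ ^ 2 ≤ ‖y - x‖ ^ 2)
    (hy' : y' = lam • u + gam • y + del • J y) {D ε : ℝ}
    (hx : ‖x - J x‖ ≤ ε) (hyx : ‖y - x‖ ≤ 2 * D) (hyJ : ‖y - J y‖ ≤ 2 * D)
    (hux : ‖u - x‖ ≤ 3 / 2 * D) :
    del * ‖y - J y‖ ^ 2 ≤ ‖y - x‖ ^ 2 - ‖y' - x‖ ^ 2 + 9 / 4 * D ^ 2 * lam + 8 * D * ε := by
  have hε : 0 ≤ ε := (norm_nonneg _).trans hx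
  have hD : 0 ≤ D := by linarith [norm_nonneg (y - x)]
  have hJn : ‖J y - J x‖ ≤ 2 * D := by
    refine (abs_le_of_sq_le_sq' ?_ (norm_nonneg _)).2.trans hyx
    linarith [sq_nonneg ‖(y - J y) - (x - J x)‖]
  have hJx : ‖J y - x‖ ^ 2 ≤ ‖y - x‖ ^ 2 - ‖y - J y‖ ^ 2 + 8 * D * ε := by
    have e : J y - x = (J y - J x) - (x - J x) := by abel
    have h1 : inner ℝ ((y - J y) - (J y - J x)) (x - J x) ≤ 4 * D * ε := by
      refine (real_inner_le_norm _ _).trans ?_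
      gcongr
      exact (norm_sub_le _ _).trans (by linarith)
    rw [inner_sub_left] at h1
    rw [norm_sub_sq_real (y - J y) (x - J x)] at hJ
    rw [e, norm_sub_sq_real]
    linarith
  have e : y' - x = lam • (u - x) + gam • (y - x) + del • (J y - x) := by
    have e1 : lam = 1 - gam - del := by linarith
    rw [hy', e1]; module
  have h2 := norm_convexComb_sq_le hlam hgam hdel hsum (u - x) (y - x) (J y - x)
  rw [← e] at h2
  have h3 : lam * ‖u - x‖ ^ 2 ≤ lam * (3 / 2 * D) ^ 2 := by gcongr
  have h4 := mul_le_mul_of_nonneg_left hJx hdel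
  have h5 : del * (8 * D * ε) ≤ 1 * (8 * D * ε) := by gcongr; linarith
  have h6 : 0 ≤ lam * ‖y - x‖ ^ 2 := by positivity
  have e7 : gam = 1 - lam - del := by linarith
  rw [e7] at h2
  linarith

/-- One step changes the inner product with `u - x` little, if `lam` and `‖y - z‖` are small. -/
theorem inner_step_sub_le (hlam : 0 ≤ lam) (hdel : 0 ≤ del) (hdel1 : del ≤ 1)
    (hsum : lam + gam + del = 1) {u x y y' z : H} (hy' : y' = lam • u + gam • y + del • z) {D : ℝ}
    (hux : ‖u - x‖ ≤ 3 / 2 * D) (huy : ‖u - y‖ ≤ 3 / 2 * D) :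
    inner ℝ (u - x) (y' - x) ≤ inner ℝ (u - x) (y - x) + 9 / 4 * D ^ 2 * lam
      + 3 / 2 * D * ‖y - z‖ := by
  have hD : 0 ≤ 3 / 2 * D := (norm_nonneg _).trans hux
  have e : y' - x = (y - x) + (lam • (u - y) - del • (y - z)) := by
    have e1 : lam = 1 - gam - del := by linarith
    rw [hy', e1]; module
  have h1 : ‖lam • (u - y) - del • (y - z)‖ ≤ lam * (3 / 2 * D) + 1 * ‖y - z‖ := by
    refine (norm_sub_le _ _).trans ?_
    rw [norm_smul, norm_smul, Real.norm_of_nonneg hlam, Real.norm_of_nonneg hdel]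
    gcongr
  have h2 := (real_inner_le_norm (u - x) (lam • (u - y) - del • (y - z))).trans
    (mul_le_mul hux h1 (norm_nonneg _) hD)
  rw [e, inner_add_right]
  linarith

end Step

/-! ### The two cases for scalar sequences -/

section Scalar

theorem le_one_div_of_sq_mul_sq_le {ρ N : ℝ} (hN : 0 < N) (h : N ^ 2 * ρ ^ 2 ≤ 1) :
    ρ ≤ 1 / N := by
  rw [le_div_iff₀ hN, mul_comm]
  refine (abs_le_of_sq_le_sq' ?_ zero_le_one).2
  rwa [mul_pow, one_pow]

/-- If `s` is almost constant from `a` to `T`, the displacements `ρ` and then the inner products `q`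
are small there, and the recursion pushes `s` below `1 / K` from `σ` on. The three contributions to
the final bound are `1 / (3 K)` from the starting value, `1 / (16 K)` from the inner products and
`1 / (6 K)` from the accumulated error `ε`. -/
theorem le_of_nearly_constant (s q ρ lam : ℕ → ℝ) {D K c N ε : ℝ} {a σ T : ℕ}
    (hD : 1 ≤ D) (hK : 1 ≤ K) (hc : 1 ≤ c) (hN : 1 ≤ N) (hε : 0 ≤ ε)
    (hlam0 : ∀ i, 0 ≤ lam i) (hlam1 : ∀ i, lam i ≤ 1) (hsa : s a ≤ 4 * D ^ 2)
    (hdec : ∀ i, a ≤ i → i ≤ T → 12 * c * N ^ 2 * (s i - s (i + 1)) ≤ 1)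
    (hlam : ∀ i, a ≤ i → 96 * c * D ^ 2 * N ^ 2 * lam i ≤ 1)
    (hstep : ∀ i, a ≤ i → i ≤ T →
      s (i + 1) ≤ (1 - lam i) * s i + 2 * lam i * q (i + 1) + (4 * D + 1) * ε)
    (hρ : ∀ i, a ≤ i → i ≤ T →
      ρ i ^ 2 ≤ c * (s i - s (i + 1) + 9 / 4 * D ^ 2 * lam i + 8 * D * ε))
    (hq : ∀ i, ρ i ≤ 1 / N → 32 * K ^ 2 * q i ≤ 1)
    (hε1 : 22 * c * N ^ 2 * (6 * D + 1) * ε ≤ 1) (hε2 : 6 * K * (T + 1) * (6 * D + 1) * ε ≤ 1)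
    (hσ : ∀ m, σ ≤ m → Real.log (12 * D ^ 2 * K) ≤ ∑ i ∈ Finset.Ico a m, lam i)
    {m : ℕ} (ham : a ≤ m) (hσm : σ ≤ m) (hmT : m ≤ T) : s m ≤ 1 / K := by
  have hqi : ∀ i, a ≤ i → i ≤ T → q i ≤ 1 / (32 * K ^ 2) := by
    intro i hai hiT
    rw [le_div_iff₀' (by positivity)]
    refine hq i (le_one_div_of_sq_mul_sq_le (by linarith) ?_)
    have h1 := mul_le_mul_of_nonneg_left (hρ i hai hiT) (sq_nonneg N)
    have h2 := hdec i hai hiT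
    have h3 := hlam i hai
    have h4 : 0 ≤ c * N ^ 2 * ε := by positivity
    linarith
  have h := le_exp_neg_sum_mul_add s lam hlam0 hlam1 (M := 4 * D ^ 2) (B := 1 / (16 * K ^ 2))
    (η := (4 * D + 1) * ε) (by positivity) (by positivity) (by positivity) ham hsa (by
      intro i hai him
      have h1 := hstep i hai (by omega)
      have h2 := mul_le_mul_of_nonneg_left (hqi (i + 1) (by omega) (by omega)) (hlam0 i)
      have e : 1 / (16 * K ^ 2) = 2 * (1 / (32 * K ^ 2)) := by field_simp; norm_num
      rw [e]
      linarith)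
  have h1 : Real.exp (-∑ i ∈ Finset.Ico a m, lam i) * (4 * D ^ 2) ≤ 1 / (3 * K) := by
    have h2 : Real.exp (-∑ i ∈ Finset.Ico a m, lam i) ≤ (12 * D ^ 2 * K)⁻¹ := by
      rw [← Real.exp_log (show 0 < 12 * D ^ 2 * K by positivity), ← Real.exp_neg, Real.exp_le_exp]
      exact neg_le_neg (hσ m hσm)
    calc _ ≤ (12 * D ^ 2 * K)⁻¹ * (4 * D ^ 2) := by gcongr
      _ = _ := by field_simp; norm_num
  have h3 : ((m - a : ℕ) : ℝ) * ((4 * D + 1) * ε) ≤ 1 / (6 * K) := by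
    rw [le_div_iff₀ (by positivity)]
    have h4 : ((m - a : ℕ) : ℝ) ≤ T + 1 := by
      have : m - a ≤ T + 1 := by omega
      exact_mod_cast this
    calc _ = 6 * K * ((m - a : ℕ) : ℝ) * (4 * D + 1) * ε := by ring
      _ ≤ 6 * K * (T + 1) * (6 * D + 1) * ε := by gcongr; linarith
      _ ≤ 1 := hε2
  have h5 : 1 / (16 * K ^ 2) ≤ 1 / (16 * K) := by gcongr; nlinarith
  have e1 : 1 / (3 * K) = 1 / 3 * (1 / K) := by field_simp
  have e2 : 1 / (6 * K) = 1 / 6 * (1 / K) := by field_simp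
  have e3 : 1 / (16 * K) = 1 / 16 * (1 / K) := by field_simp
  have : 0 < 1 / K := by positivity
  linarith

/-- At a step where the squared distance does not decrease, from `s` to `s'`, the displacement is at
most `1 / r`, so that `q'` is small, and dividing the recursion by `lam ≥ 1 / h` bounds `s'`. -/
theorem le_of_increasing_step {s s' q q' ρ lam D K c N r h ε : ℝ} (hD : 1 ≤ D) (hK : 1 ≤ K)
    (hc : 1 ≤ c) (hN : 1 ≤ N) (hε : 0 ≤ ε) (hss' : s ≤ s') (hh : 0 < h) (hlam0 : 0 < lam)
    (hlam1 : lam ≤ 1)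
    (hlamh : 1 / h ≤ lam) (hρ0 : 0 ≤ ρ)
    (hNr : N ≤ r) (hKr : 128 * D * K ^ 2 ≤ r)
    (hlamr : 16 * c * r ^ 2 * D ^ 2 * lam ≤ 1) (hlamK : 256 * D ^ 2 * K ^ 2 * lam ≤ 1)
    (hstep : s' ≤ (1 - lam) * s + 2 * lam * q' + (4 * D + 1) * ε)
    (hρ : ρ ^ 2 ≤ c * (s - s' + 9 / 4 * D ^ 2 * lam + 8 * D * ε))
    (hq : ρ ≤ 1 / N → 32 * K ^ 2 * q ≤ 1)
    (hq' : q' ≤ q + 9 / 4 * D ^ 2 * lam + 3 / 2 * D * ρ)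
    (hε1 : 4 * c * r ^ 2 * (6 * D + 1) * ε ≤ 1) (hε2 : 16 * h * K ^ 2 * (6 * D + 1) * ε ≤ 1) :
    s' ≤ 1 / K := by
  have hr : 1 ≤ r := hN.trans hNr
  have hρr : ρ ≤ 1 / r := by
    refine le_one_div_of_sq_mul_sq_le (by linarith) ?_
    have h1 := mul_le_mul_of_nonneg_left hρ (sq_nonneg r)
    have h2 : 0 ≤ r ^ 2 * c * (s' - s) := mul_nonneg (by positivity) (by linarith)
    have h4 : 0 ≤ c * r ^ 2 * ε := by positivity
    linarith
  have h1 := hq (hρr.trans (by gcongr))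
  -- multiplying by `K ^ 2` turns every bound into a linear one
  have h2 : K ^ 2 * (D * ρ) ≤ 1 / 128 := by
    rw [le_div_iff₀ (by linarith)] at hρr
    have := mul_le_mul_of_nonneg_left hKr hρ0
    linarith
  have h3 := mul_le_mul_of_nonneg_left hq' (sq_nonneg K)
  -- `53 / 1024 = 1 / 32 + 9 / 1024 + 3 / 256`
  have h4 : K ^ 2 * q' ≤ 53 / 1024 := by linarith
  have h5 : 16 * K ^ 2 * ((6 * D + 1) * ε) ≤ lam := by
    refine le_trans ?_ hlamh
    rw [le_div_iff₀ hh]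
    linarith
  have h6 : lam * s' ≤ 2 * lam * q' + (4 * D + 1) * ε := by
    have := mul_le_mul_of_nonneg_left hss' (by linarith : 0 ≤ 1 - lam)
    linarith
  have h7 : lam * (K ^ 2 * s') ≤ lam * 1 := by
    have h8 := mul_le_mul_of_nonneg_left h6 (sq_nonneg K)
    have h9 := mul_le_mul_of_nonneg_left h4 hlam0.le
    have h10 : 0 ≤ K ^ 2 * (D * ε) := by positivity
    linarith
  have h11 : K ^ 2 * s' ≤ 1 := le_of_mul_le_mul_left h7 hlam0
  rw [le_div_iff₀ (by linarith)]
  rcases le_total s' 0 with h0 | h0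
  · nlinarith
  · nlinarith [mul_nonneg h0 (by linarith : 0 ≤ K)]

/-- From `a` to `σ̄(k, a)` the sum of the `lam i` reaches `log (12 D² (k + 1))`, because the terms
before `a` contribute at most `a`. -/
theorem log_le_sum_Ico (lam : ℕ → ℝ) (hlam0 : ∀ i, 0 ≤ lam i) (hlam1 : ∀ i, lam i ≤ 1)
    {L : ℕ → ℕ} (hL : ∀ k : ℕ, (k : ℝ) ≤ ∑ i ∈ Finset.Icc 1 (L k), lam i) (k D a : ℕ) {m : ℕ}
    (hm : sigmaBar L D k a ≤ m) :
    Real.log (12 * (D : ℝ) ^ 2 * ((k : ℝ) + 1)) ≤ ∑ i ∈ Finset.Ico a m, lam i := by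
  set x := Real.log (12 * (D : ℝ) ^ 2 * ((k : ℝ) + 1)) with hx
  have h1 := hL (a + ⌈x⌉₊)
  have hsub : Finset.Icc 1 (L (a + ⌈x⌉₊)) ⊆ Finset.range a ∪ Finset.Ico a m := by
    intro i hi
    have : L (a + ⌈x⌉₊) + 1 ≤ m := hm
    simp only [Finset.mem_Icc, Finset.mem_union, Finset.mem_range, Finset.mem_Ico] at hi ⊢
    omega
  have h2 := Finset.sum_le_sum_of_subset_of_nonneg hsub fun i _ _ => hlam0 i
  have h4 := Finset.sum_union_inter (s₁ := Finset.range a) (s₂ := Finset.Ico a m) (f := lam)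
  have h5 : 0 ≤ ∑ i ∈ Finset.range a ∩ Finset.Ico a m, lam i :=
    Finset.sum_nonneg fun i _ => hlam0 i
  have h3 : ∑ i ∈ Finset.range a, lam i ≤ a := by
    simpa using Finset.sum_le_card_nsmul (Finset.range a) lam 1 fun i _ => hlam1 i
  push_cast at h1
  linarith [Nat.le_ceil x]

/-- Since all `lam i ≤ 1`, the rate of divergence satisfies `n ≤ L n`. -/
theorem lt_sigmaBar (lam : ℕ → ℝ) (hlam1 : ∀ i, lam i ≤ 1)
    {L : ℕ → ℕ} (hL : ∀ k : ℕ, (k : ℝ) ≤ ∑ i ∈ Finset.Icc 1 (L k), lam i) (k D a : ℕ) :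
    a < sigmaBar L D k a := by
  have h1 : ∀ n, n ≤ L n := fun n => by
    have h2 : ∑ i ∈ Finset.Icc 1 (L n), lam i ≤ L n := by
      simpa using Finset.sum_le_card_nsmul (Finset.Icc 1 (L n)) lam 1 fun i _ => hlam1 i
    exact_mod_cast (hL n).trans h2
  exact Nat.lt_succ_of_le ((Nat.le_add_right _ _).trans (h1 _))

/-- If `s` increases somewhere before `i`, then after the last increase before `i` the sequence
only decreases down to `s i`. -/
theorem exists_last_increase (s : ℕ → ℝ) {i₀ i : ℕ} (hi : i₀ < i) (h₀ : s i₀ < s (i₀ + 1)) :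
    ∃ τ, i₀ ≤ τ ∧ τ < i ∧ s τ < s (τ + 1) ∧ s i ≤ s (τ + 1) := by
  induction i, hi using Nat.le_induction with
  | base => exact ⟨i₀, le_rfl, by omega, h₀, le_rfl⟩
  | succ i hi ih =>
    obtain ⟨τ, h1, h2, h3, h4⟩ := ih
    rcases lt_or_ge (s i) (s (i + 1)) with h | h
    · exact ⟨i, by omega, by omega, h, le_rfl⟩
    · exact ⟨τ, h1, by omega, h3, h.trans h4⟩

end Scalar

/-! ### Boundedness of the iteration and comparison of resolvents -/

section Iteration

variable {H : Type*} [NormedAddCommGroup H] [InnerProductSpace ℝ H] [CompleteSpace H]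

theorem IsMaximalMonotoneOp.norm_resolvent_sub_zero_le {A : H → Set H}
    (hA : IsMaximalMonotoneOp A) {σ : ℝ} (hσ : 0 < σ) {p : H} (hp : p ∈ zeros A) (x : H) :
    ‖resolvent A σ x - p‖ ≤ ‖x - p‖ := by
  simpa [hA.resolvent_eq_self hσ hp] using hA.norm_resolvent_sub_le hσ x p

theorem IsMaximalMonotoneOp.norm_iterate_sub_le {A : H → Set H} (hA : IsMaximalMonotoneOp A)
    {cs lam gam del : ℕ → ℝ} (hcs : ∀ n, 0 < cs n) (hlam : ∀ n, 0 ≤ lam n)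
    (hgam : ∀ n, 0 ≤ gam n) (hdel : ∀ n, 0 ≤ del n) (hsum : ∀ n, lam n + gam n + del n = 1)
    {u : H} {y : ℕ → H}
    (hy : ∀ n, y (n + 1) = lam n • u + gam n • y n + del n • resolvent A (cs n) (y n))
    {p : H} (hp : p ∈ zeros A) {D : ℝ} (hu : ‖u - p‖ ≤ D) (hy0 : ‖y 0 - p‖ ≤ D) (n : ℕ) :
    ‖y n - p‖ ≤ D := by
  induction n with
  | zero => exact hy0
  | succ n ih =>
    have e : y (n + 1) - p =
        lam n • (u - p) + gam n • (y n - p) + del n • (resolvent A (cs n) (y n) - p) := by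
      have e1 : lam n = 1 - gam n - del n := by linarith [hsum n]
      rw [hy, e1]; module
    have hJ := (hA.norm_resolvent_sub_zero_le (hcs n) hp (y n)).trans ih
    rw [e]
    refine norm_add₃_le.trans ?_
    rw [norm_smul, norm_smul, norm_smul, Real.norm_of_nonneg (hlam n),
      Real.norm_of_nonneg (hgam n), Real.norm_of_nonneg (hdel n)]
    calc _ ≤ lam n * D + gam n * D + del n * D :=
          add_le_add (add_le_add (mul_le_mul_of_nonneg_left hu (hlam n))
            (mul_le_mul_of_nonneg_left ih (hgam n))) (mul_le_mul_of_nonneg_left hJ (hdel n))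
      _ = D := by rw [← add_mul, ← add_mul, hsum, one_mul]

/-- `zeta` converts an approximate fixed point of `J_{1/c}` into one of `J_{c_i}`, `i ≤ n`. -/
theorem IsMaximalMonotoneOp.norm_sub_resolvent_le_of_zeta {A : H → Set H}
    (hA : IsMaximalMonotoneOp A) {cs : ℕ → ℝ} {c : ℕ} (hc : c ≠ 0)
    (hcs : ∀ n, 1 / (c : ℝ) ≤ cs n) {C : ℕ → ℕ} (hCmono : Monotone C)
    (hC : ∀ n, cs n ≤ (C n : ℝ)) {x : H} {X m n : ℕ} (hX : zeta c C m n ≤ X)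
    (hx : ‖resolvent A (1 / (c : ℝ)) x - x‖ ≤ 1 / ((X : ℝ) + 1)) {i : ℕ} (hi : i ≤ n) :
    ‖x - resolvent A (cs i) x‖ ≤ 1 / ((m : ℝ) + 1) := by
  have hc0 : (0 : ℝ) < c := by exact_mod_cast Nat.pos_of_ne_zero hc
  have hCi : cs i ≤ C n := (hC i).trans (by exact_mod_cast hCmono hi)
  have hCn : (0 : ℝ) < C n := (lt_of_lt_of_le (by positivity) (hcs i)).trans_le hCi
  have hXr : (c : ℝ) * (m + 1) * C n ≤ X + 1 := by
    have h1 : c * (m + 1) * C n ≤ X + 1 := by unfold zeta at hX; omega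
    exact_mod_cast h1
  rw [norm_sub_rev] at hx
  calc _ ≤ cs i / (1 / c) * ‖x - resolvent A (1 / (c : ℝ)) x‖ :=
        (hA.norm_sub_resolvent_mono (by positivity) (hcs i) x).2
    _ ≤ C n / (1 / c) * (1 / (c * (m + 1) * C n)) := by
        gcongr
        exact hx.trans (by gcongr)
    _ = _ := by field_simp

end Iteration

/-! ### Monotonicity of the functions in the bound -/

section Bounds

theorem sigmaBar_mono {L : ℕ → ℕ} (hL : Monotone L) (D k : ℕ) : Monotone (sigmaBar L D k) :=
  fun _ _ h => Nat.succ_le_succ (hL (Nat.add_le_add_right h _))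

theorem fTilde2_mono {f L : ℕ → ℕ} (hf : Monotone f) (hL : Monotone L) (k D : ℕ) :
    Monotone (fTilde2 k f L D) :=
  fun _ _ h => Nat.add_le_add_right (hf (sigmaBar_mono hL D k h)) 2

theorem r1_mono (c : ℕ) : Monotone (r1 c) := fun _ _ h => by
  unfold r1; gcongr

theorem r3_mono {l : ℕ → ℕ} (hl : Monotone l) (k c D : ℕ) : Monotone (r3 k c l D) :=
  fun _ _ h => hl (by unfold r2; gcongr)

theorem r1_add_one {c : ℕ} (hc : c ≠ 0) (n : ℕ) : r1 c n + 1 = 12 * c * (n + 1) ^ 2 :=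
  Nat.sub_add_cancel (Nat.one_le_iff_ne_zero.2 (by positivity))

theorem cast_sub_one_add_one {X : ℕ} (hX : X ≠ 0) : ((X - 1 : ℕ) : ℝ) + 1 = X := by
  rw [Nat.cast_pred (Nat.pos_of_ne_zero hX), sub_add_cancel]

/-- If `g` gains at least `1` in each relevant step, then `φ₁` exceeds the number of iterations that
enters its definition, and so also `n`. -/
theorem le_phi1 {c D : ℕ} (hc : c ≠ 0) (hD : D ≠ 0) {g : ℕ → ℕ} (hg : Monotone g) {n a : ℕ}
    (hgain : ∀ m ≤ phi2 D (r1 c n) a g, m + 1 ≤ g m) : n ≤ phi1 D (r1 c n) a g := by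
  have h5 : ∀ j ≤ 4 * D ^ 2 * (r1 c n + 1), j ≤ g^[j] a := by
    intro j hj
    induction j with
    | zero => exact Nat.zero_le _
    | succ j ih =>
      have h7 := hgain _ (iterate_le_max_iterate hg a (by omega : j ≤ 4 * D ^ 2 * (r1 c n + 1)))
      rw [Function.iterate_succ_apply']
      have := ih (by omega)
      omega
  have h8 : n ≤ 4 * D ^ 2 * (r1 c n + 1) := by
    rw [r1_add_one hc]
    have h9 : 1 ≤ D ^ 2 * c := Nat.one_le_iff_ne_zero.2 (by positivity)
    nlinarith
  have h10 := hgain _ le_rfl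
  exact ((h8.trans (h5 _ le_rfl)).trans (le_max_right _ _)).trans
    ((Nat.le_add_right _ 1).trans h10)

end Bounds

/-! ### The two cases with the explicit bounds -/

section Cases

/-- The scalar inequalities satisfied along the iteration by `s i = ‖y i - x‖ ^ 2`,
`q i = ⟪u - x, y i - x⟫` and the displacements `ρ i = ‖y i - J_{c_i} (y i)‖`, where
`ε i = ‖x - J_{c_i} x‖` for the approximate projection `x` of `u` onto the zeros. -/
structure StepEstimates (s q ρ lam ε : ℕ → ℝ) (D c K N : ℝ) : Prop where
  nonneg : ∀ i, 0 ≤ s i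
  le_sq : ∀ i, s i ≤ 4 * D ^ 2
  lam_nonneg : ∀ i, 0 ≤ lam i
  lam_le_one : ∀ i, lam i ≤ 1
  disp_nonneg : ∀ i, 0 ≤ ρ i
  step : ∀ i t, ε i ≤ t → t ≤ 1 →
    s (i + 1) ≤ (1 - lam i) * s i + 2 * lam i * q (i + 1) + (4 * D + 1) * t
  disp_sq_le : ∀ i t, ε i ≤ t →
    ρ i ^ 2 ≤ c * (s i - s (i + 1) + 9 / 4 * D ^ 2 * lam i + 8 * D * t)
  inner_le : ∀ i, ρ i ≤ 1 / N → 32 * K ^ 2 * q i ≤ 1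
  inner_succ_le : ∀ i, q (i + 1) ≤ q i + 9 / 4 * D ^ 2 * lam i + 3 / 2 * D * ρ i

variable {s q ρ lam ε : ℕ → ℝ} {c D k n₀ : ℕ}

/-- The case of a sequence `s` that decreases from `a` to `g φ`. -/
theorem StepEstimates.exists_le_of_decreasing {f g L : ℕ → ℕ} {a φ mx : ℕ}
    (hE : StepEstimates s q ρ lam ε D c ((k : ℝ) + 1) ((n₀ : ℝ) + 1)) (hc : c ≠ 0) (hD : D ≠ 0)
    (hf : Monotone f) (hL : Monotone L) (hg : Monotone g)
    (hLsum : ∀ k : ℕ, (k : ℝ) ≤ ∑ i ∈ Finset.Icc 1 (L k), lam i)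
    (hgf : ∀ n, g n = f (sigmaBar L D k n) + 2) (hφ : φ = phi2 D (r1 c n₀) a g) (hag : a ≤ g a)
    (hlam : ∀ i, a ≤ i → 96 * c * (D : ℝ) ^ 2 * ((n₀ : ℝ) + 1) ^ 2 * lam i ≤ 1)
    (hmx₁ : r1 c n₀ ≤ mx) (hmx₂ : 3 * (k + 1) * (f (sigmaBar L D k φ) + 1) ≤ mx)
    (hε : ∀ i ≤ g φ, ε i ≤ 1 / (2 * (6 * D + 1) * mx))
    (hdec : ∀ i, a ≤ i → i < g φ → s (i + 1) ≤ s i) :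
    ∃ n ≤ φ, ∀ i ∈ Set.Icc (sigmaBar L D k n) (f (sigmaBar L D k n)),
      s i ≤ 1 / ((k : ℝ) + 1) := by
  have hD1 : (1 : ℝ) ≤ D := by exact_mod_cast Nat.one_le_iff_ne_zero.2 hD
  have hc1 : (1 : ℝ) ≤ c := by exact_mod_cast Nat.one_le_iff_ne_zero.2 hc
  have hN1 : 1 ≤ (n₀ : ℝ) + 1 := by linarith [Nat.cast_nonneg (α := ℝ) n₀]
  have hK1 : 1 ≤ (k : ℝ) + 1 := by linarith [Nat.cast_nonneg (α := ℝ) k]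
  have hr1 : ((r1 c n₀ : ℕ) : ℝ) + 1 = 12 * c * ((n₀ : ℝ) + 1) ^ 2 := by
    exact_mod_cast r1_add_one hc n₀
  have hanti : ∀ i j, a ≤ i → i ≤ j → j ≤ g φ → s j ≤ s i := by
    intro i j hai hij
    induction j, hij using Nat.le_induction with
    | base => exact fun _ => le_rfl
    | succ j hij ih => exact fun hj => (hdec j (hai.trans hij) hj).trans (ih (by omega))
  obtain ⟨j, hj, hjs⟩ := exists_iterate_sub_le s g a (M := 4 * (D : ℝ) ^ 2)
    (η := 1 / ((r1 c n₀ : ℕ) + 1)) (R := 4 * D ^ 2 * (r1 c n₀ + 1)) hE.nonneg (hE.le_sq a)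
    (by push_cast; field_simp; rfl) (by positivity)
  have han : a ≤ g^[j] a := hg.monotone_iterate_of_le_map hag (Nat.zero_le j)
  have hnφ : g^[j] a ≤ φ := hφ ▸ iterate_le_max_iterate hg a hj.le
  rw [Function.iterate_succ_apply', hr1, le_div_iff₀' (by positivity)] at hjs
  generalize g^[j] a = n at hjs han hnφ
  have hgn := hg hnφ
  obtain ⟨T, hT⟩ : ∃ T, T = f (sigmaBar L D k n) := ⟨_, rfl⟩
  have hgT : g n = T + 2 := by rw [hgf, hT]
  have h1N : 1 ≤ c * ((n₀ : ℝ) + 1) ^ 2 := one_le_mul_of_one_le_of_one_le hc1 (one_le_pow₀ hN1)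
  have hmx₁' : 11 * c * ((n₀ : ℝ) + 1) ^ 2 ≤ mx := by
    have h1 : ((r1 c n₀ : ℕ) : ℝ) ≤ mx := by exact_mod_cast hmx₁
    linarith
  have hmx₂' : 3 * ((k : ℝ) + 1) * (T + 1) ≤ mx := by
    have h1 : 3 * (k + 1) * (T + 1) ≤ mx := by
      refine le_trans ?_ hmx₂
      rw [hT]
      gcongr
      exact hf (sigmaBar_mono hL D k hnφ)
    exact_mod_cast h1
  have hmx0 : (1 : ℝ) ≤ mx := by linarith
  refine ⟨n, hnφ, fun i hi => ?_⟩
  rw [← hT] at hi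
  refine le_of_nearly_constant s q ρ lam hD1 hK1 hc1 hN1
    (ε := 1 / (2 * (6 * D + 1) * mx)) (a := n) (σ := sigmaBar L D k n) (T := T)
    (by positivity) hE.lam_nonneg hE.lam_le_one (hE.le_sq _) (fun i h1 h2 => ?_)
    (fun i h1 => hlam i (han.trans h1))
    (fun i h1 h2 => hE.step i _ (hε i (by omega)) ?_)
    (fun i h1 h2 => hE.disp_sq_le i _ (hε i (by omega))) hE.inner_le ?_ ?_
    (fun m hm => log_le_sum_Ico lam hE.lam_nonneg hE.lam_le_one hLsum k D n hm)
    ((lt_sigmaBar lam hE.lam_le_one hLsum k D n).le.trans hi.1) hi.1 hi.2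
  · have h3 := hanti n i han h1 (by omega)
    have h4 := hanti (i + 1) (g n) (by omega) (by omega) hgn
    refine le_trans ?_ hjs
    gcongr
  · rw [div_le_one (by positivity)]
    exact one_le_mul_of_one_le_of_one_le (by linarith) hmx0
  · rw [mul_one_div, div_le_one (by positivity)]
    linarith [mul_le_mul_of_nonneg_right hmx₁' (by positivity : (0 : ℝ) ≤ 2 * (6 * D + 1))]
  · rw [mul_one_div, div_le_one (by positivity)]
    linarith [mul_le_mul_of_nonneg_right hmx₂' (by positivity : (0 : ℝ) ≤ 2 * (6 * D + 1))]

/-- The case of an increase of `s` at `τ`. The number `r` may exceed `r₂(n₀)`, since the bound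
evaluates `r₂` at `Φ(n₀) ≥ n₀`. -/
theorem StepEstimates.le_of_increase {r h mx τ : ℕ}
    (hE : StepEstimates s q ρ lam ε D c ((k : ℝ) + 1) ((n₀ : ℝ) + 1)) (hc : c ≠ 0) (hD : D ≠ 0)
    (hinc : s τ ≤ s (τ + 1)) (hh : h ≠ 0) (hlamh : 1 / (h : ℝ) ≤ lam τ)
    (hr : r2 k D n₀ ≤ r) (hlamr : 16 * c * ((r2 k D n₀ : ℕ) : ℝ) ^ 2 * (D : ℝ) ^ 2 * lam τ ≤ 1)
    (hlamk : 256 * (D : ℝ) ^ 2 * ((k : ℝ) + 1) ^ 2 * lam τ ≤ 1)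
    (hmx : max (16 * h * (k + 1) ^ 2 * (6 * D + 1)) (4 * c * r ^ 2 * (6 * D + 1)) ≤ mx)
    (hε : ε τ ≤ 1 / ((mx : ℝ) + 1)) : s (τ + 1) ≤ 1 / ((k : ℝ) + 1) := by
  have hD1 : (1 : ℝ) ≤ D := by exact_mod_cast Nat.one_le_iff_ne_zero.2 hD
  have hc1 : (1 : ℝ) ≤ c := by exact_mod_cast Nat.one_le_iff_ne_zero.2 hc
  have hh0 : (0 : ℝ) < h := by exact_mod_cast Nat.pos_of_ne_zero hh
  have hN1 : 1 ≤ (n₀ : ℝ) + 1 := by linarith [Nat.cast_nonneg (α := ℝ) n₀]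
  have hK1 : 1 ≤ (k : ℝ) + 1 := by linarith [Nat.cast_nonneg (α := ℝ) k]
  have hmx₁ : 16 * h * ((k : ℝ) + 1) ^ 2 * (6 * D + 1) ≤ (mx : ℝ) := by
    exact_mod_cast (le_max_left _ _).trans hmx
  have hmx₂ : 4 * c * ((r2 k D n₀ : ℕ) : ℝ) ^ 2 * (6 * D + 1) ≤ (mx : ℝ) := by
    have h1 : 4 * c * (r2 k D n₀) ^ 2 * (6 * D + 1) ≤ mx := by
      refine le_trans ?_ ((le_max_right _ _).trans hmx)
      gcongr
    exact_mod_cast h1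
  have hNr : (n₀ : ℝ) + 1 ≤ (r2 k D n₀ : ℕ) := by
    have : n₀ + 1 ≤ r2 k D n₀ := le_trans (by omega) (le_max_left _ _)
    exact_mod_cast this
  have hKr : 128 * D * ((k : ℝ) + 1) ^ 2 ≤ (r2 k D n₀ : ℕ) := by
    exact_mod_cast (le_max_right _ _ : 128 * D * (k + 1) ^ 2 ≤ r2 k D n₀)
  have hmx0 : (0 : ℝ) ≤ mx := Nat.cast_nonneg _
  refine le_of_increasing_step hD1 hK1 hc1 hN1 (ε := 1 / ((mx : ℝ) + 1)) (by positivity) hinc hh0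
    (lt_of_lt_of_le (by positivity) hlamh) (hE.lam_le_one τ) hlamh (hE.disp_nonneg τ) hNr hKr hlamr
    hlamk (hE.step τ _ hε ?_) (hE.disp_sq_le τ _ hε) (hE.inner_le τ) (hE.inner_succ_le τ) ?_ ?_
  · rw [div_le_one (by positivity)]; linarith
  · rw [mul_one_div, div_le_one (by positivity)]; linarith
  · rw [mul_one_div, div_le_one (by positivity)]; linarith

end Cases

/-! ### The estimates along the iteration -/

section Estimates

variable {H : Type*} [NormedAddCommGroup H] [InnerProductSpace ℝ H] [CompleteSpace H]

theorem IsMaximalMonotoneOp.stepEstimates {A : H → Set H} (hA : IsMaximalMonotoneOp A)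
    {cs lam gam del : ℕ → ℝ} {c D k n₀ : ℕ} (hc : c ≠ 0) (hcs : ∀ n, 1 / (c : ℝ) ≤ cs n)
    (hlam : ∀ n, lam n ∈ Set.Ioo (0 : ℝ) 1) (hgam : ∀ n, 0 ≤ gam n)
    (hdel : ∀ n, del n ∈ Set.Ioo (0 : ℝ) 1) (hdelc : ∀ n, 1 / (c : ℝ) ≤ del n ^ 2)
    (hsum : ∀ n, lam n + gam n + del n = 1) {u : H} {y : ℕ → H}
    (hy : ∀ n, y (n + 1) = lam n • u + gam n • y n + del n • resolvent A (cs n) (y n))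
    {p : H} (hp : p ∈ zeros A) (hup : ‖u - p‖ ≤ D / 2) (hy0 : ‖y 0 - p‖ ≤ D)
    {x : H} (hxp : ‖x - p‖ ≤ D)
    (hproj : ∀ v, ‖v - p‖ ≤ D → ‖resolvent A (1 / (c : ℝ)) v - v‖ ≤ 1 / ((n₀ : ℝ) + 1) →
      32 * ((k : ℝ) + 1) ^ 2 * inner ℝ (u - x) (v - x) ≤ 1) :
    StepEstimates (fun i => ‖y i - x‖ ^ 2) (fun i => inner ℝ (u - x) (y i - x))
      (fun i => ‖y i - resolvent A (cs i) (y i)‖) lam (fun i => ‖x - resolvent A (cs i) x‖)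
      D c ((k : ℝ) + 1) ((n₀ : ℝ) + 1) := by
  have hc0 : (0 : ℝ) < c := by exact_mod_cast Nat.pos_of_ne_zero hc
  have hcs0 : ∀ n, 0 < cs n := fun n => lt_of_lt_of_le (by positivity) (hcs n)
  have hyp : ∀ n, ‖y n - p‖ ≤ D := hA.norm_iterate_sub_le hcs0 (fun n => (hlam n).1.le) hgam
    (fun n => (hdel n).1.le) hsum hy hp (by linarith [norm_nonneg (u - p)]) hy0
  have htri : ∀ v w : H, ∀ a b : ℝ, ‖v - p‖ ≤ a → ‖w - p‖ ≤ b → ‖v - w‖ ≤ a + b :=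
    fun v w a b hv hw => by
      rw [← sub_sub_sub_cancel_right v w p]
      exact (norm_sub_le _ _).trans (add_le_add hv hw)
  have hux : ‖u - x‖ ≤ 3 / 2 * D := (htri _ _ _ _ hup hxp).trans_eq (by ring)
  have huy : ∀ i, ‖u - y i‖ ≤ 3 / 2 * D := fun i =>
    (htri _ _ _ _ hup (hyp i)).trans_eq (by ring)
  have hyx : ∀ i, ‖y i - x‖ ≤ 2 * D := fun i => (htri _ _ _ _ (hyp i) hxp).trans_eq (by ring)
  have hyJ : ∀ i, ‖y i - resolvent A (cs i) (y i)‖ ≤ 2 * D := fun i =>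
    (htri _ _ _ _ (hyp i)
      ((hA.norm_resolvent_sub_zero_le (hcs0 i) hp (y i)).trans (hyp i))).trans_eq (by ring)
  refine ⟨fun i => sq_nonneg _, fun i => ?_, fun i => (hlam i).1.le, fun i => (hlam i).2.le,
    fun i => norm_nonneg _, fun i t ht ht1 => ?_, fun i t ht => ?_, fun i hi => ?_, fun i => ?_⟩
  · calc ‖y i - x‖ ^ 2 ≤ (2 * (D : ℝ)) ^ 2 := by gcongr; exact hyx i
      _ = 4 * (D : ℝ) ^ 2 := by ring
  · exact norm_step_sub_sq_le (hlam i).1.le (hgam i) (hdel i).1.le (hsum i)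
      (hA.norm_resolvent_sub_le (hcs0 i) _ _) (hy i) ht1 ht (hyx i)
  · have h2 := mul_norm_sub_map_sq_le (hlam i).1.le (hgam i) (hdel i).1.le (hsum i)
      (hA.norm_resolvent_sub_sq_le (hcs0 i) _ _) (hy i) ht (hyx i) (hyJ i) hux
    have h3 : 1 / (c : ℝ) ≤ del i :=
      (hdelc i).trans (pow_le_of_le_one (hdel i).1.le (hdel i).2.le two_ne_zero)
    refine le_trans ?_ (mul_le_mul_of_nonneg_left h2 hc0.le)
    rw [← mul_assoc]
    refine le_mul_of_one_le_left (sq_nonneg _) ?_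
    rwa [div_le_iff₀' hc0] at h3
  · refine hproj (y i) (hyp i) ?_
    rw [norm_sub_rev]
    exact ((hA.norm_sub_resolvent_mono (by positivity) (hcs i) (y i)).1).trans hi
  · exact inner_step_sub_le (hlam i).1.le (hdel i).1.le (hdel i).2.le (hsum i) (hy i) hux (huy i)

end Estimates
end MPPA

open MPPA in
theorem mainTheorem1
    {H : Type*} [NormedAddCommGroup H] [InnerProductSpace ℝ H] [CompleteSpace H]
    (A : H → Set H) (hA : MPPA.IsMaximalMonotoneOp A)
    -- the parameters and the errors of the iterations
    (cs lam gam del : ℕ → ℝ) (e : ℕ → H)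
    (hcs : ∀ n, 0 < cs n)
    (hlam : ∀ n, lam n ∈ Set.Ioo (0 : ℝ) 1)
    (hdel : ∀ n, del n ∈ Set.Ioo (0 : ℝ) 1)
    (hgam : ∀ n, gam n ∈ Set.Ico (0 : ℝ) 1)
    (hsum : ∀ n, lam n + gam n + del n = 1)
    -- the inexact iteration `z` and the exact iteration `y`
    (u : H) (z y : ℕ → H)
    (hz : ∀ n, z (n + 1) =
      lam n • u + gam n • z n + del n • MPPA.resolvent A (cs n) (z n) + e n)
    (hy0 : y 0 = z 0)
    (hy : ∀ n, y (n + 1) =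
      lam n • u + gam n • y n + del n • MPPA.resolvent A (cs n) (y n))
    -- the quantitative conditions
    (c : ℕ) (hc : c ≠ 0)
    (h l L E : ℕ → ℕ) (hh : Monotone h) (hh0 : ∀ n, h n ≠ 0)
    (hl : Monotone l) (hL : Monotone L) (hE : Monotone E)
    (Q1 : ∀ n, lam n ≥ 1 / (h n : ℝ))
    (Q2 : ∀ k n, l k ≤ n → lam n ≤ 1 / ((k : ℝ) + 1))
    (Q3 : ∀ k : ℕ, (k : ℝ) ≤ ∑ i ∈ Finset.Icc 1 (L k), lam i)
    (Q4 : ∀ n, 1 / (c : ℝ) ≤ min (cs n) (del n ^ 2))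
    (Q5 : (∀ k n : ℕ, ∑ i ∈ Finset.Icc (E k + 1) (E k + n), ‖e i‖ ≤ 1 / ((k : ℝ) + 1)) ∨
      (∀ k n : ℕ, E k ≤ n → ‖e n‖ / lam n ≤ 1 / ((k : ℝ) + 1)))
    -- the bound `D`, the zero `p` of `A`, and the bound `C` on the `c_n`
    (D : ℕ) (hD0 : D ≠ 0) (p : H) (hp : p ∈ MPPA.zeros A)
    (hD : max (2 * ‖u - p‖) ‖z 0 - p‖ ≤ (D : ℝ))
    (C : ℕ → ℕ) (hCmono : Monotone C) (hC : ∀ n, cs n ≤ (C n : ℝ))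
    (k : ℕ) (f : ℕ → ℕ) (hf : Monotone f) :
    ∃ n ≤ MPPA.mu c C l L D h k f, ∃ x ∈ Metric.closedBall p (D : ℝ),
      ∀ i ∈ Set.Icc n (f n), ‖y i - x‖ ^ 2 ≤ 1 / ((k : ℝ) + 1) := by
  obtain ⟨hDu, hDz⟩ := max_le_iff.1 hD
  have hD1 : (1 : ℝ) ≤ D := by exact_mod_cast Nat.one_le_iff_ne_zero.2 hD0
  have hc1 : (1 : ℝ) ≤ c := by exact_mod_cast Nat.one_le_iff_ne_zero.2 hc
  have hc0 : (0 : ℝ) < 1 / (c : ℝ) := by positivity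
  have hlam1 : ∀ n, lam n ≤ 1 := fun n => (hlam n).2.le
  have hcs' : ∀ n, 1 / (c : ℝ) ≤ cs n := fun n => (Q4 n).trans (min_le_left _ _)
  have hup : ‖u - p‖ ≤ D / 2 := by linarith
  have hlamQ : ∀ (X i : ℕ), l X ≤ i → ((X : ℝ) + 1) * lam i ≤ 1 := fun X i hi => by
    have := Q2 X i hi
    rwa [le_div_iff₀' (by positivity)] at this
  obtain ⟨g, hg_def⟩ : ∃ g, g = fTilde2 k f L D := ⟨_, rfl⟩
  have hg : Monotone g := hg_def ▸ fTilde2_mono hf hL k D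
  have hgf : ∀ n, g n = f (sigmaBar L D k n) + 2 := fun n => by rw [hg_def]; rfl
  obtain ⟨b, hb⟩ : ∃ b, b = betaXi k f c C l L D h := ⟨_, rfl⟩
  obtain ⟨M, hM⟩ : ∃ M, M = phi2 D (r1 c b) (r3 k c l D b) g := ⟨_, rfl⟩
  have hmu : mu c C l L D h k f = max (sigmaBar L D k M) (g M) := by rw [hM, hb, hg_def]; rfl
  rw [hmu]
  -- a point where `f` drops below the identity gives an empty interval, and the claim is trivial
  by_cases hvac : ∃ m ≤ M, f (sigmaBar L D k m) < sigmaBar L D k m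
  · obtain ⟨m, hm, hfm⟩ := hvac
    refine ⟨sigmaBar L D k m, (sigmaBar_mono hL D k hm).trans (le_max_left _ _), p, by simp,
      fun i hi => ?_⟩
    have := hi.1.trans hi.2
    omega
  push Not at hvac
  have hgain : ∀ m ≤ M, m + 1 ≤ g m := fun m hm => by
    have h1 := hvac m hm
    have h2 := lt_sigmaBar lam hlam1 Q3 k D m
    rw [hgf]
    omega
  obtain ⟨n₀, hn₀, x, hxp, hxJ, hproj⟩ := exists_approx_projection
    (hA.norm_resolvent_sub_le hc0) (hA.resolvent_eq_self hc0 hp) hD0 hup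
    (32 * (k + 1) ^ 2 - 1) (Xi k f c C l L D h)
  replace hn₀ : n₀ ≤ b := hb ▸ hn₀
  have hest := hA.stepEstimates (k := k) hc hcs' hlam (fun n => (hgam n).1) hdel
    (fun n => (Q4 n).trans (min_le_right _ _)) hsum hy hp hup (by rwa [hy0]) hxp
    (fun v hv hvJ => by
      have h1 := hproj v hv hvJ
      rw [cast_sub_one_add_one (by positivity), le_div_iff₀' (by positivity)] at h1
      exact_mod_cast h1)
  obtain ⟨a, ha⟩ : ∃ a, a = r3 k c l D n₀ := ⟨_, rfl⟩
  obtain ⟨φ, hφ⟩ : ∃ φ, φ = phi2 D (r1 c n₀) a g := ⟨_, rfl⟩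
  have hφM : φ ≤ M := by
    rw [hφ, hM, ha]
    exact phi2_mono hg D (r1_mono c hn₀) (r3_mono hl k c D hn₀)
  have hag : a ≤ g a :=
    (Nat.le_add_right a 1).trans (hgain a ((hφ ▸ le_max_left _ _ : a ≤ φ).trans hφM))
  have hε : ∀ m n, zeta c C m n ≤ Xi k f c C l L D h n₀ → ∀ i ≤ n,
      ‖x - resolvent A (cs i) x‖ ≤ 1 / ((m : ℝ) + 1) := fun m n hmn i hi =>
    hA.norm_sub_resolvent_le_of_zeta hc hcs' hCmono hC hmn hxJ hi
  by_cases hdec : ∀ i, a ≤ i → i < g φ → ‖y (i + 1) - x‖ ^ 2 ≤ ‖y i - x‖ ^ 2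
  · obtain ⟨mx, hmx⟩ : ∃ mx, mx = max (r1 c n₀) (r4 k c f l D L n₀) := ⟨_, rfl⟩
    have hmx0 : mx ≠ 0 := by
      have h1 := r1_add_one hc n₀
      have h2 : 0 < c * (n₀ + 1) ^ 2 := by positivity
      have h3 : r1 c n₀ ≤ mx := hmx ▸ le_max_left _ _
      intro h0
      rw [mul_assoc] at h1
      omega
    obtain ⟨n, hn, hmain⟩ := hest.exists_le_of_decreasing (mx := mx) hc hD0 hf hL hg Q3 hgf hφ hag
      (fun i hi => by
        have h1 := hlamQ (96 * c * D ^ 2 * (n₀ + 1) ^ 2 - 1) i ((hl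
          ((le_max_left _ _).trans (le_max_left _ _))).trans (ha ▸ hi))
        rw [cast_sub_one_add_one (by positivity)] at h1
        exact_mod_cast h1)
      (hmx ▸ le_max_left _ _) (by rw [hmx, hφ, ha, hg_def]; exact le_max_right _ _)
      (fun i hi => by
        have h1 := hε (2 * (6 * D + 1) * mx - 1) (g φ)
          (by rw [hmx, hφ, ha, hg_def]; exact le_max_left _ _) i hi
        rw [cast_sub_one_add_one (by positivity)] at h1
        exact_mod_cast h1) hdec
    exact ⟨_, (sigmaBar_mono hL D k (hn.trans hφM)).trans (le_max_left _ _), x,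
      mem_closedBall_iff_norm.2 hxp, hmain⟩
  · push Not at hdec
    obtain ⟨i₀, hai₀, hi₀, hsi₀⟩ := hdec
    refine ⟨g φ, (hg hφM).trans (le_max_right _ _), x, mem_closedBall_iff_norm.2 hxp,
      fun i hi => ?_⟩
    obtain ⟨τ, h1, h2, h3, h4⟩ :=
      exists_last_increase (fun i => ‖y i - x‖ ^ 2) (hi₀.trans_le hi.1) hsi₀
    -- `τ` is the last increase before `i`, so that `s i ≤ s (τ + 1)`
    have haτ : r3 k c l D n₀ ≤ τ := ha ▸ hai₀.trans h1
    have hτf : τ ≤ f (g φ) := h2.le.trans hi.2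
    have hn₀φ : n₀ ≤ g φ := by
      rw [hφ]
      exact le_phi1 hc hD0 hg fun m hm => hgain m ((hφ ▸ hm : m ≤ φ).trans hφM)
    refine h4.trans (hest.le_of_increase hc hD0 h3.le (hh0 (f (g φ))) ?_ (r := r2 k D (g φ)) ?_ ?_ ?_
      le_rfl (hε _ (f (g φ)) ?_ τ hτf))
    · refine le_trans ?_ (Q1 τ)
      have h5 : 0 < h τ := Nat.pos_of_ne_zero (hh0 τ)
      gcongr
      exact hh hτf
    · unfold r2
      gcongr
    · have h5 := hlamQ (16 * c * (r2 k D n₀) ^ 2 * D ^ 2) τ ((hl (le_max_right _ _)).trans haτ)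
      push_cast at h5
      linarith [(hlam τ).1]
    · have h5 := hlamQ (256 * D ^ 2 * (k + 1) ^ 2 - 1) τ
        ((hl ((le_max_right _ _).trans (le_max_left _ _))).trans haτ)
      rw [cast_sub_one_add_one (by positivity)] at h5
      exact_mod_cast h5
    · rw [hφ, ha, hg_def]
      exact le_max_right _ _
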